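/- All Hilbert spaces are complex; let $d\in\{0,1,2,\dots\}\cup\{\infty\}$ be fixed, let $\Gamma=\bigoplus_{n\ge 0}\ell^2(d)^{\otimes n}$ be the full Fock space over $\ell^2(d)$ (so $\ell^2(d)=\mathbb C^d$ for finite $d$), with orthonormal basis $e_\alpha$ indexed by the words $\alpha$ in $d$ letters, and let $L_i$ be its creation operators, $L_ie_\alpha=e_{i\alpha}$. A $d$-tuple $C=(C_1,\dots,C_d)$ of operators on a Hilbert space $H_C$ (a sequence if $d=\infty$) is a *row contraction* if $(\xi_i)\mapsto\sum_i C_i\xi_i$ is a contraction $\bigoplus_1^d H_C\to H_C$. Its defect operator is $D_C=(\delta_{ij}I-C_i^*C_j)^{1/2}_{d\times d}$ on $\bigoplus_1^d H_C$, its defect space is $\mathcal D_C=\overline{\operatorname{range} D_C}$, and its *defect* is the Hilbert space dimension of $\mathcal D_C$. A *contractive lifting* of $C$ is a row contraction $E$ on a Hilbert space $H_E=H_C\oplus H_A$ of the block form $E_i=\begin{pmatrix}C_i&0\\B_i&A_i\end{pmatrix}$; it is *minimal* if $\overline{\operatorname{span}}\{E_\alpha x: x\in H_C,\ \alpha \text{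 a word}\}=H_E$, where $E_\alpha=E_{\alpha_1}\cdots E_{\alpha_m}$ for $\alpha=\alpha_1\cdots\alpha_m$. Two liftings $E,E'$ of $C$ are *unitarily equivalent* if there is a unitary $H_E\to H_{E'}$ that intertwines $E$ and $E'$ and is the identity on $H_C$. For a contractive lifting $E$ of $C$ let $V=V^E$ be the minimal isometric dilation of $E$ on $H_E\oplus(\Gamma\otimes\mathcal D_E)$, given by $V_i(x\oplus f)=E_ix\oplus\big(e_\emptyset\otimes D_E(e_i\otimes x)+(L_i\otimes I)f\big)$. The formula $e_\alpha\otimes D_C\xi\mapsto V_\alpha\sum_i(V_i-C_i)\xi_i$ (for $\xi\in\bigoplus_1^dH_C$) defines an isometry of $\Gamma\otimes\mathcal D_C$ into this space; let $M_{C,E}:\Gamma\otimes\mathcal D_E\to\Gamma\otimes\mathcal D_C$ be the orthogonal projection onto its range, restricted to $\Gamma\otimes\mathcal D_E$ and read in $\Gamma\otimes\mathcal D_C$ (for minimal $E$, this is the characteristic function of the lifting). Its symbol is $\Theta_{C,E}:\mathcal D_E\to\Gamma\otimes\mathcal D_C$, $\Theta_{C,E}(\delta)=M_{C,E}(e_\emptyset\otimes\delta)$.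 **Statement.** Let $C$ on $H_C$ and $C'$ on $H_{C'}$ be row contractions ($d$-tuples with the same $d$) with the same defect. Then there is a one-to-one correspondence between the set of unitary equivalence classes of minimal contractive liftings of $C$ and the set of unitary equivalence classes of minimal contractive liftings of $C'$. More precisely, there exist unitaries $u:\mathcal D_C\to\mathcal D_{C'}$, and for every such $u$ there is a bijection $\Phi_u$ from the first set onto the second such that, for all minimal contractive liftings $E$ of $C$ and $E'$ of $C'$, $\Phi_u([E])=[E']$ if and only if $E$ and $E'$ have equivalent characteristic functions after identifying $\mathcal D_C$ with $\mathcal D_{C'}$ by $u$, that is, if and only if there is a unitary $v:\mathcal D_E\to\mathcal D_{E'}$ with $\Theta_{C',E'}\circ v=(I\otimes u)\circ\Theta_{C,E}$. -/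

import Mathlib

universe u

namespace RowLifting

noncomputable section

/-- `ℓ²(κ; G)`: the Hilbert space direct sum of copies of `G` indexed by `κ`, canonically
`ℓ²(κ) ⊗ G`. With `κ = ι` it is `⨁_ι G`; with `κ = List ι` (the words with letters in `ι`) it is
`Γ ⊗ G`, where `Γ` is the full Fock space over `ℓ²(ι)`. -/
abbrev L2 (κ : Type) (G : Type u) [NormedAddCommGroup G] : Type u :=
  lp (fun _ : κ => G) 2

section L2

variable {κ κ' : Type} {G G' F : Type u} [NormedAddCommGroup G] [InnerProductSpace ℂ G]
  [NormedAddCommGroup G'] [InnerProductSpace ℂ G'] [NormedAddCommGroup F] [InnerProductSpace ℂ F]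

open Classical in
/-- The isometry `x ↦ e_k ⊗ x` from `G` into `ℓ²(κ; G)`. -/
def single (k : κ) : G →ₗᵢ[ℂ] L2 κ G where
  toLinearMap := lp.lsingle (𝕜 := ℂ) (E := fun _ : κ => G) 2 k
  norm_map' x := lp.norm_single (E := fun _ : κ => G) (by norm_num) k x

open Classical in
theorem single_eq (k : κ) (x : G) : single k x = lp.single (E := fun _ : κ => G) 2 k x := rfl

theorem inner_single_left (k : κ) (x : G) (f : L2 κ G) :
    inner ℂ (single k x) f = inner ℂ x (f k) := by
  classical
  rw [single_eq]
  exact lp.inner_single_left (𝕜 := ℂ) (G := fun _ : κ => G) k x f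

theorem inner_single_of_ne {k l : κ} (h : k ≠ l) (x y : G) :
    inner ℂ (single k x) (single l y) = 0 := by
  classical
  rw [inner_single_left, single_eq, lp.single_apply_ne _ _ _ h, inner_zero_right]

theorem hasSum_single (f : L2 κ G) : HasSum (fun k => single k (f k)) f := by
  classical
  exact lp.hasSum_single (E := fun _ : κ => G) (p := 2) (by norm_num) f

/-- The isometry `e_k ⊗ x ↦ e_{g k} ⊗ f x` from `ℓ²(κ; G)` into `ℓ²(κ'; G')` induced by an
injection `g` of the index sets and an isometry `f` of the Hilbert spaces. -/
def push [CompleteSpace G'] (g : κ → κ') (hg : Function.Injective g) (f : G →ₗᵢ[ℂ] G') :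
    L2 κ G →ₗᵢ[ℂ] L2 κ' G' :=
  OrthogonalFamily.linearIsometry (𝕜 := ℂ) (G := fun _ : κ => G)
    (V := fun k => (single (g k)).comp f)
    (fun _ _ h x y => inner_single_of_ne (fun e => h (hg e)) (f x) (f y))

theorem push_single [CompleteSpace G'] (g : κ → κ') (hg : Function.Injective g) (f : G →ₗᵢ[ℂ] G')
    (k : κ) (x : G) : push g hg f (single k x) = single (g k) (f x) := by
  classical
  rw [single_eq]
  exact OrthogonalFamily.linearIsometry_apply_single (𝕜 := ℂ) (G := fun _ : κ => G) _ x

theorem inner_push_eq_zero [CompleteSpace G'] (g : κ → κ') (hg : Function.Injective g)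
    (f : G →ₗᵢ[ℂ] G') (z : L2 κ' G') (h : ∀ k x, inner ℂ z (single (g k) (f x)) = 0)
    (y : L2 κ G) : inner ℂ z (push g hg f y) = 0 := by
  have h1 := ((hasSum_single y).mapL (push g hg f).toContinuousLinearMap).mapL (innerSL ℂ z)
  have h2 : HasSum (fun _ : κ => (0 : ℂ)) (inner ℂ z (push g hg f y)) := by
    refine Eq.mp (congrArg (fun a => HasSum a _) (funext fun k => ?_)) h1
    exact (congrArg (inner ℂ z) (push_single g hg f k (y k))).trans (h k (y k))
  exact h2.unique hasSum_zero

/-- The inclusion of the first summand of a Hilbert space direct sum. -/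
def inl : G →ₗᵢ[ℂ] WithLp 2 (G × F) where
  toLinearMap := (WithLp.linearEquiv 2 ℂ (G × F)).symm.toLinearMap ∘ₗ LinearMap.inl ℂ G F
  norm_map' x := by simp 

/-- The inclusion of the second summand of a Hilbert space direct sum. -/
def inr : F →ₗᵢ[ℂ] WithLp 2 (G × F) where
  toLinearMap := (WithLp.linearEquiv 2 ℂ (G × F)).symm.toLinearMap ∘ₗ LinearMap.inr ℂ G F
  norm_map' x := by simp 

theorem inl_fst (x : G) : (inl x : WithLp 2 (G × F)).fst = x := rfl
theorem inl_snd (x : G) : (inl x : WithLp 2 (G × F)).snd = 0 := rfl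
theorem inr_fst (x : F) : (inr x : WithLp 2 (G × F)).fst = 0 := rfl
theorem inr_snd (x : F) : (inr x : WithLp 2 (G × F)).snd = x := rfl

end L2

/-- The positive square root of a positive operator on a Hilbert space. -/
def opSqrt {G : Type u} [NormedAddCommGroup G] [InnerProductSpace ℂ G] [CompleteSpace G]
    (A : G →L[ℂ] G) : G →L[ℂ] G := CFC.sqrt A

theorem inner_opSqrt {G : Type u} [NormedAddCommGroup G] [InnerProductSpace ℂ G]
    [CompleteSpace G] (A : G →L[ℂ] G) (hA : 0 ≤ A) (x y : G) :
    inner ℂ (opSqrt A x) (opSqrt A y) = inner ℂ x (A y) := by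
  have h1 : IsSelfAdjoint (opSqrt A) := (CFC.sqrt_nonneg A).isSelfAdjoint
  have h2 : opSqrt A * opSqrt A = A := CFC.sqrt_mul_sqrt_self A hA
  rw [← ContinuousLinearMap.adjoint_inner_right, h1.adjoint_eq]
  conv_rhs => rw [← h2]
  rfl

theorem one_sub_adjoint_nonneg {G F : Type u} [NormedAddCommGroup G] [InnerProductSpace ℂ G]
    [CompleteSpace G] [NormedAddCommGroup F] [InnerProductSpace ℂ F] [CompleteSpace F]
    (A : G →L[ℂ] F) (hA : ‖A‖ ≤ 1) : 0 ≤ 1 - ContinuousLinearMap.adjoint A ∘L A := by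
  rw [ContinuousLinearMap.nonneg_iff_isPositive, ContinuousLinearMap.isPositive_iff_complex]
  intro x
  have h1 : inner ℂ ((1 - ContinuousLinearMap.adjoint A ∘L A) x) x
      = ((‖x‖ ^ 2 - ‖A x‖ ^ 2 : ℝ) : ℂ) := by
    have h2 : (1 - ContinuousLinearMap.adjoint A ∘L A) x
        = x - ContinuousLinearMap.adjoint A (A x) := rfl
    rw [h2, inner_sub_left, ContinuousLinearMap.adjoint_inner_left,
      inner_self_eq_norm_sq_to_K, inner_self_eq_norm_sq_to_K]
    push_cast
    rfl
  have h3 : ‖A x‖ ≤ ‖x‖ := (A.le_of_opNorm_le hA x).trans_eq (one_mul _)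
  rw [h1]
  refine ⟨by rw [RCLike.re_to_complex, Complex.ofReal_re], ?_⟩
  have h4 : ‖A x‖ ^ 2 ≤ ‖x‖ ^ 2 := pow_le_pow_left₀ (norm_nonneg _) h3 2
  simpa only [RCLike.re_to_complex, Complex.ofReal_re, sub_nonneg] using h4

/-- A row contraction `T = (T_i)_{i ∈ ι}` on `H`, given by the contraction
`row : ⨁_ι H → H`, `ξ ↦ ∑ i, T_i ξ_i`. -/
structure RowContraction (ι : Type) (H : Type u) [NormedAddCommGroup H]
    [InnerProductSpace ℂ H] where
  row : L2 ι H →L[ℂ] H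
  norm_row_le : ‖row‖ ≤ 1

namespace RowContraction

variable {ι : Type} {H : Type u} [NormedAddCommGroup H] [InnerProductSpace ℂ H]

/-- The `i`-th entry `T_i` of the row contraction. -/
def op (T : RowContraction ι H) (i : ι) : H →L[ℂ] H :=
  T.row ∘L (single i).toContinuousLinearMap

/-- `T_α = T_{α₁} ⋯ T_{αₘ}` for a word `α`; the empty word gives the identity. -/
def wordOp (T : RowContraction ι H) : List ι → (H →L[ℂ] H)
  | [] => ContinuousLinearMap.id ℂ H
  | i :: α => T.op i ∘L T.wordOp α

variable [CompleteSpace H]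

/-- The defect operator `D_T = (1 - T* T)^{1/2} = (δ_{ij} - T_i* T_j)^{1/2}` on `⨁_ι H`. -/
def defectOp (T : RowContraction ι H) : L2 ι H →L[ℂ] L2 ι H :=
  opSqrt (1 - ContinuousLinearMap.adjoint T.row ∘L T.row)

/-- The defect space `𝒟_T`, the closure of the range of `D_T`. -/
def defectSpace (T : RowContraction ι H) : Submodule ℂ (L2 ι H) :=
  T.defectOp.range.topologicalClosure

instance (T : RowContraction ι H) : CompleteSpace T.defectSpace :=
  T.defectOp.range.isClosed_topologicalClosure.completeSpace_coe

/-- `D_T` as an operator into the defect space. -/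
def toDefect (T : RowContraction ι H) : L2 ι H →L[ℂ] T.defectSpace :=
  T.defectOp.codRestrict T.defectSpace
    (fun x => Submodule.le_topologicalClosure _ ⟨x, rfl⟩)

end RowContraction

/-- The Hilbert space dimension: the (least) cardinality of an orthonormal basis. -/
def hilbertDim (G : Type u) [NormedAddCommGroup G] [InnerProductSpace ℂ G] : Cardinal.{u} :=
  sInf {c | ∃ s : Set G, Nonempty (HilbertBasis s ℂ G) ∧ Cardinal.mk s = c}

namespace RowContraction

variable {ι : Type} {H : Type u} [NormedAddCommGroup H] [InnerProductSpace ℂ H] [CompleteSpace H]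

/-- The defect of a row contraction: the Hilbert space dimension of its defect space. -/
def defect (T : RowContraction ι H) : Cardinal.{u} := hilbertDim T.defectSpace

theorem inner_row_add_inner_defect (T : RowContraction ι H) (x y : L2 ι H) :
    inner ℂ (T.row x) (T.row y) + inner ℂ (T.toDefect x) (T.toDefect y) = inner ℂ x y := by
  have h1 : inner ℂ (T.toDefect x) (T.toDefect y) = inner ℂ (T.defectOp x) (T.defectOp y) := rfl
  have h2 : (1 - ContinuousLinearMap.adjoint T.row ∘L T.row) y
      = y - ContinuousLinearMap.adjoint T.row (T.row y) := rfl
  rw [h1, defectOp, inner_opSqrt _ (one_sub_adjoint_nonneg _ T.norm_row_le), h2, inner_sub_right,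
    ContinuousLinearMap.adjoint_inner_right]
  ring

theorem denseRange_toDefect (T : RowContraction ι H) : DenseRange T.toDefect := by
  have hset : Set.range (Subtype.val ∘ T.toDefect) = (T.defectOp.range : Set (L2 ι H)) := rfl
  intro y
  rw [closure_subtype, ← Set.range_comp, hset]
  exact y.2

/-- The space `H ⊕ (Γ ⊗ 𝒟_T)` of the canonical minimal isometric dilation `V^T` of `T`. -/
abbrev DilSpace (T : RowContraction ι H) : Type u :=
  WithLp 2 (H × L2 (List ι) T.defectSpace)

/-- The restriction of the row isometry `V^T` to `⨁_ι H`, that is,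
`ξ ↦ ∑ i, V_i ξ_i = (T ξ, e_∅ ⊗ D_T ξ)`. -/
def dilCol (T : RowContraction ι H) : L2 ι H →L[ℂ] T.DilSpace :=
  inl.toContinuousLinearMap ∘L T.row +
    (inr.comp (single [])).toContinuousLinearMap ∘L T.toDefect

/-- The creation operator `L_i ⊗ 1 : e_α ⊗ δ ↦ e_{iα} ⊗ δ` on `Γ ⊗ 𝒟_T`. -/
def creation (T : RowContraction ι H) (i : ι) :
    L2 (List ι) T.defectSpace →ₗᵢ[ℂ] L2 (List ι) T.defectSpace :=
  push (List.cons i) List.cons_injective LinearIsometry.id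

/-- The underlying bounded operator of `dilOp`. -/
def dilOpAux (T : RowContraction ι H) (i : ι) : T.DilSpace →L[ℂ] T.DilSpace :=
  T.dilCol ∘L (single i).toContinuousLinearMap ∘L WithLp.fstL 2 ℂ _ _ +
    (inr.comp (T.creation i)).toContinuousLinearMap ∘L WithLp.sndL 2 ℂ _ _

theorem dilCol_apply (T : RowContraction ι H) (x : L2 ι H) :
    T.dilCol x = inl (T.row x) + inr (single [] (T.toDefect x)) := rfl

theorem dilOpAux_apply (T : RowContraction ι H) (i : ι) (a : T.DilSpace) :
    T.dilOpAux i a = T.dilCol (single i a.fst) + inr (T.creation i a.snd) := rfl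

theorem inner_dilCol (T : RowContraction ι H) (x y : L2 ι H) :
    inner ℂ (T.dilCol x) (T.dilCol y) = inner ℂ x y := by
  have h : inner ℂ (T.dilCol x) (T.dilCol y) = inner ℂ (T.row x + 0) (T.row y + 0)
      + inner ℂ (0 + single ([] : List ι) (T.toDefect x)) (0 + single [] (T.toDefect y)) := rfl
  rw [h, add_zero, add_zero, zero_add, zero_add, LinearIsometry.inner_map_map,
    inner_row_add_inner_defect]

theorem inner_single_creation (T : RowContraction ι H) (i : ι) (x : T.defectSpace)
    (f : L2 (List ι) T.defectSpace) : inner ℂ (single [] x) (T.creation i f) = 0 :=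
  inner_push_eq_zero _ _ _ _ (fun α y => inner_single_of_ne (by simp) x y) f

theorem inner_creation_creation (T : RowContraction ι H) {i k : ι} (h : i ≠ k)
    (f g : L2 (List ι) T.defectSpace) : inner ℂ (T.creation i f) (T.creation k g) = 0 := by
  refine inner_push_eq_zero _ _ _ _ (fun α y => ?_) g
  rw [← inner_conj_symm]
  refine (congrArg _ (inner_push_eq_zero _ _ _ _ (fun β z => ?_) f)).trans (map_zero _)
  refine inner_single_of_ne ?_ _ _
  simp [Ne.symm h]

theorem inner_dilCol_inr_creation (T : RowContraction ι H) (i : ι) (x : L2 ι H)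
    (f : L2 (List ι) T.defectSpace) : inner ℂ (T.dilCol x) (inr (T.creation i f)) = 0 := by
  have h : inner ℂ (T.dilCol x) (inr (T.creation i f)) = inner ℂ (T.row x + 0) 0
      + inner ℂ (0 + single ([] : List ι) (T.toDefect x)) (T.creation i f) := rfl
  rw [h, inner_zero_right, zero_add, zero_add, inner_single_creation]

theorem inner_inr_creation_dilCol (T : RowContraction ι H) (i : ι) (x : L2 ι H)
    (f : L2 (List ι) T.defectSpace) : inner ℂ (inr (T.creation i f)) (T.dilCol x) = 0 := by
  rw [← inner_conj_symm, inner_dilCol_inr_creation, map_zero]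

theorem inner_dilOpAux_self (T : RowContraction ι H) (i : ι) (a b : T.DilSpace) :
    inner ℂ (T.dilOpAux i a) (T.dilOpAux i b) = inner ℂ a b := by
  rw [dilOpAux_apply, dilOpAux_apply, inner_add_left, inner_add_right, inner_add_right,
    inner_dilCol, inner_dilCol_inr_creation, inner_inr_creation_dilCol,
    LinearIsometry.inner_map_map, LinearIsometry.inner_map_map, LinearIsometry.inner_map_map,
    add_zero, zero_add]
  rfl

theorem inner_dilOpAux_of_ne (T : RowContraction ι H) {i k : ι} (h : i ≠ k) (a b : T.DilSpace) :
    inner ℂ (T.dilOpAux i a) (T.dilOpAux k b) = 0 := by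
  rw [dilOpAux_apply, dilOpAux_apply, inner_add_left, inner_add_right, inner_add_right,
    inner_dilCol, inner_dilCol_inr_creation, inner_inr_creation_dilCol,
    LinearIsometry.inner_map_map, inner_single_of_ne h, inner_creation_creation T h]
  ring

/-- The entries of the canonical minimal isometric dilation `V^T` on `H ⊕ (Γ ⊗ 𝒟_T)`:
`V_i (x, f) = (T_i x, e_∅ ⊗ D_T (e_i ⊗ x) + (L_i ⊗ 1) f)`. They are isometries with mutually
orthogonal ranges. -/
def dilOp (T : RowContraction ι H) (i : ι) : T.DilSpace →ₗᵢ[ℂ] T.DilSpace where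
  toLinearMap := (T.dilOpAux i).toLinearMap
  norm_map' a := by
    have h := T.inner_dilOpAux_self i a a
    rw [inner_self_eq_norm_sq_to_K, inner_self_eq_norm_sq_to_K] at h
    have h' : ‖T.dilOpAux i a‖ ^ 2 = ‖a‖ ^ 2 := by exact_mod_cast h
    exact (pow_left_inj₀ (norm_nonneg _) (norm_nonneg _) two_ne_zero).1 h'

/-- `V_α = V_{α₁} ⋯ V_{αₘ}` for a word `α`. -/
def dilWord (T : RowContraction ι H) : List ι → (T.DilSpace →ₗᵢ[ℂ] T.DilSpace)
  | [] => LinearIsometry.id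
  | i :: α => (T.dilOp i).comp (T.dilWord α)

end RowContraction

/-- A contractive lifting of `C`: a Hilbert space `space` containing `H` (through the isometry
`embed`) and a row contraction `E` on it which, with respect to `H ⊕ Hᗮ`, has the block form
`E_i = (C_i, 0; B_i, A_i)`, i.e. `P_H E_i x = C_i x` for `x ∈ H` and `P_H E_i y = 0` for
`y ∈ Hᗮ`. (`embed†` is the projection onto `H`.) -/
structure ContractiveLifting {ι : Type} {H : Type u} [NormedAddCommGroup H]
    [InnerProductSpace ℂ H] [CompleteSpace H] (C : RowContraction ι H) where
  space : Type u
  [normedAddCommGroup : NormedAddCommGroup space]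
  [innerProductSpace : InnerProductSpace ℂ space]
  [completeSpace : CompleteSpace space]
  embed : H →ₗᵢ[ℂ] space
  tuple : RowContraction ι space
  compress : ∀ i x,
    ContinuousLinearMap.adjoint embed.toContinuousLinearMap (tuple.op i (embed x)) = C.op i x
  lower : ∀ i y, ContinuousLinearMap.adjoint embed.toContinuousLinearMap y = 0 →
    ContinuousLinearMap.adjoint embed.toContinuousLinearMap (tuple.op i y) = 0

attribute [instance] ContractiveLifting.normedAddCommGroup ContractiveLifting.innerProductSpace
  ContractiveLifting.completeSpace

namespace ContractiveLifting

variable {ι : Type} {H : Type u} [NormedAddCommGroup H] [InnerProductSpace ℂ H] [CompleteSpace H]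
  {C : RowContraction ι H}

/-- Minimality: the vectors `E_α x` with `x ∈ H` and `α` a word span a dense subspace. -/
def IsMinimal (E : ContractiveLifting C) : Prop :=
  (Submodule.span ℂ {y : E.space | ∃ (α : List ι) (x : H),
    y = E.tuple.wordOp α (E.embed x)}).topologicalClosure = ⊤

/-- Unitary equivalence of liftings of `C`: a unitary that intertwines the two tuples and is the
identity on `H`. -/
def UnitarilyEquivalent (E E' : ContractiveLifting C) : Prop :=
  ∃ U : E.space ≃ₗᵢ[ℂ] E'.space,
    (∀ i y, U (E.tuple.op i y) = E'.tuple.op i (U y)) ∧ ∀ x, U (E.embed x) = E'.embed x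

theorem inner_op_embed (E : ContractiveLifting C) (i : ι) (x h : H) :
    inner ℂ (E.tuple.op i (E.embed x)) (E.embed h) = inner ℂ (C.op i x) h := by
  rw [← E.compress i x, ContinuousLinearMap.adjoint_inner_left]
  rfl

theorem inner_op_eq_zero (E : ContractiveLifting C) (i : ι) (y : E.space)
    (hy : ∀ h, inner ℂ y (E.embed h) = 0) (h : H) :
    inner ℂ (E.tuple.op i y) (E.embed h) = 0 := by
  have h0 : ContinuousLinearMap.adjoint E.embed.toContinuousLinearMap y = 0 := by
    refine ext_inner_right ℂ fun v => ?_
    rw [ContinuousLinearMap.adjoint_inner_left, inner_zero_left]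
    exact hy v
  have h1 : inner ℂ (ContinuousLinearMap.adjoint E.embed.toContinuousLinearMap
      (E.tuple.op i y)) h = 0 := by rw [E.lower i y h0, inner_zero_left]
  rw [ContinuousLinearMap.adjoint_inner_left] at h1
  exact h1

/-- The inclusion `⨁_ι H ⊆ ⨁_ι H_E`. -/
def embedSum (E : ContractiveLifting C) : L2 ι H →ₗᵢ[ℂ] L2 ι E.space :=
  push id Function.injective_id E.embed

theorem inner_row_embedSum (E : ContractiveLifting C) (ξ : L2 ι H) (h : H) :
    inner ℂ (E.embed h) (E.tuple.row (E.embedSum ξ)) = inner ℂ h (C.row ξ) := by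
  have h1 := (((hasSum_single ξ).mapL E.embedSum.toContinuousLinearMap).mapL
    E.tuple.row).mapL (innerSL ℂ (E.embed h))
  have h2 := ((hasSum_single ξ).mapL C.row).mapL (innerSL ℂ h)
  refine h1.unique (Eq.mp (congrArg (fun a => HasSum a _) (funext fun k => ?_)) h2)
  have h3 := E.inner_op_embed k (ξ k) h
  rw [← inner_conj_symm, ← inner_conj_symm (C.op k (ξ k))] at h3
  have h4 : E.embedSum (single k (ξ k)) = single k (E.embed (ξ k)) := push_single _ _ _ _ _
  have h5 := ((starRingEnd ℂ).injective h3).symm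
  refine h5.trans ?_
  exact congrArg (fun z => inner ℂ (E.embed h) (E.tuple.row z)) h4.symm

/-- `ξ ↦ ∑ i, (V_i - C_i) ξ_i` for `ξ ∈ ⨁_ι H`, where `V = V^E` is the canonical minimal
isometric dilation of the lifting. -/
def wander (E : ContractiveLifting C) : L2 ι H →L[ℂ] E.tuple.DilSpace :=
  E.tuple.dilCol ∘L E.embedSum.toContinuousLinearMap -
    (inl.comp E.embed).toContinuousLinearMap ∘L C.row

theorem wander_apply (E : ContractiveLifting C) (ξ : L2 ι H) :
    E.wander ξ = E.tuple.dilCol (E.embedSum ξ) - inl (E.embed (C.row ξ)) := rfl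

theorem hasSum_wander (E : ContractiveLifting C) (ξ : L2 ι H) :
    HasSum (fun i => E.tuple.dilOp i (inl (E.embed (ξ i))) - inl (E.embed (C.op i (ξ i))))
      (E.wander ξ) := by
  refine Eq.mp (congrArg (fun a => HasSum a _) (funext fun k => ?_))
    ((hasSum_single ξ).mapL E.wander)
  have h1 : E.embedSum (single k (ξ k)) = single k (E.embed (ξ k)) := push_single _ _ _ _ _
  have h2 : E.tuple.dilOp k (inl (E.embed (ξ k)))
      = E.tuple.dilCol (single k (E.embed (ξ k))) + inr (E.tuple.creation k 0) := rfl
  rw [wander_apply, h1, h2, map_zero, map_zero, add_zero]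
  rfl

theorem inner_inl_dilCol (E : ContractiveLifting C) (h : H) (ξ : L2 ι H) :
    inner ℂ (inl (E.embed h)) (E.tuple.dilCol (E.embedSum ξ)) = inner ℂ h (C.row ξ) := by
  have h1 : inner ℂ (inl (E.embed h)) (E.tuple.dilCol (E.embedSum ξ))
      = inner ℂ (E.embed h) (E.tuple.row (E.embedSum ξ) + 0)
        + inner ℂ 0 (0 + single ([] : List ι) (E.tuple.toDefect (E.embedSum ξ))) := rfl
  rw [h1, inner_zero_left, add_zero, add_zero, inner_row_embedSum]

theorem inner_wander_inl (E : ContractiveLifting C) (ξ : L2 ι H) (h : H) :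
    inner ℂ (E.wander ξ) (inl (E.embed h)) = 0 := by
  rw [← inner_conj_symm, wander_apply, inner_sub_right, inner_inl_dilCol,
    LinearIsometry.inner_map_map, LinearIsometry.inner_map_map, sub_self, map_zero]

theorem inner_wander (E : ContractiveLifting C) (ξ η : L2 ι H) :
    inner ℂ (E.wander ξ) (E.wander η) = inner ℂ (C.toDefect ξ) (C.toDefect η) := by
  rw [wander_apply E η, inner_sub_right, inner_wander_inl, sub_zero, wander_apply,
    inner_sub_left, inner_inl_dilCol, RowContraction.inner_dilCol, LinearIsometry.inner_map_map,
    ← C.inner_row_add_inner_defect]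
  ring

theorem norm_wander (E : ContractiveLifting C) (ξ : L2 ι H) :
    ‖E.wander ξ‖ = ‖C.toDefect ξ‖ := by
  have h' : ‖E.wander ξ‖ ^ 2 = ‖C.toDefect ξ‖ ^ 2 := by
    rw [norm_sq_eq_re_inner (𝕜 := ℂ) (E.wander ξ), norm_sq_eq_re_inner (𝕜 := ℂ) (C.toDefect ξ),
      E.inner_wander ξ ξ]
  exact (pow_left_inj₀ (norm_nonneg _) (norm_nonneg _) two_ne_zero).1 h'

/-- The underlying operator of `defectIncl`. -/
def defectInclAux (E : ContractiveLifting C) : C.defectSpace →L[ℂ] E.tuple.DilSpace :=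
  E.wander.toLinearMap.extendOfNorm C.toDefect.toLinearMap

theorem defectInclAux_apply (E : ContractiveLifting C) (ξ : L2 ι H) :
    E.defectInclAux (C.toDefect ξ) = E.wander ξ :=
  LinearMap.extendOfNorm_eq (f := E.wander.toLinearMap) (e := C.toDefect.toLinearMap)
    C.denseRange_toDefect ⟨1, fun x => by rw [one_mul]; exact (E.norm_wander x).le⟩ ξ

/-- The canonical unitary `D_C ξ ↦ ∑ i, (V_i - C_i) ξ_i` from the defect space `𝒟_C` onto the
wandering subspace `ℒ_C = closure (span {H, V (⨁ H)}) ⊖ H`, seen in the space of `V = V^E`. -/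
def defectIncl (E : ContractiveLifting C) : C.defectSpace →ₗᵢ[ℂ] E.tuple.DilSpace where
  toLinearMap := E.defectInclAux.toLinearMap
  norm_map' δ := by
    refine C.denseRange_toDefect.induction_on (p := fun δ => ‖E.defectInclAux δ‖ = ‖δ‖) δ
      (isClosed_eq (by fun_prop) (by fun_prop)) fun ξ => ?_
    rw [defectInclAux_apply, norm_wander]

theorem defectIncl_apply (E : ContractiveLifting C) (ξ : L2 ι H) :
    E.defectIncl (C.toDefect ξ) = E.wander ξ := E.defectInclAux_apply ξ

theorem inner_defectIncl_inl (E : ContractiveLifting C) (δ : C.defectSpace) (h : H) :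
    inner ℂ (E.defectIncl δ) (inl (E.embed h)) = 0 := by
  refine C.denseRange_toDefect.induction_on
    (p := fun δ => inner ℂ (E.defectIncl δ) (inl (E.embed h)) = 0) δ
    (isClosed_eq (by fun_prop) (by fun_prop)) fun ξ => ?_
  rw [defectIncl_apply, inner_wander_inl]

theorem inner_dilWord_defectIncl_inl (E : ContractiveLifting C) (α : List ι)
    (δ : C.defectSpace) (h : H) :
    inner ℂ (E.tuple.dilWord α (E.defectIncl δ)) (inl (E.embed h)) = 0 := by
  induction α generalizing h with
  | nil => exact E.inner_defectIncl_inl δ h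
  | cons i α ih =>
    set z := E.tuple.dilWord α (E.defectIncl δ) with hz
    have hfst : ∀ h, inner ℂ z.fst (E.embed h) = 0 := fun h => by
      have h1 : inner ℂ z (inl (E.embed h)) = inner ℂ z.fst (E.embed h) + inner ℂ z.snd 0 := rfl
      rw [← ih h, h1, inner_zero_right, add_zero]
    have h2 : inner ℂ (E.tuple.dilWord (i :: α) (E.defectIncl δ)) (inl (E.embed h))
        = inner ℂ (E.tuple.op i z.fst + 0 + 0) (E.embed h)
          + inner ℂ (E.tuple.dilOp i z).snd 0 := rfl
    rw [h2, inner_zero_right, add_zero, add_zero, add_zero]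
    exact E.inner_op_eq_zero i z.fst hfst h

theorem inner_dilOp_wander (E : ContractiveLifting C) (i : ι) (α : List ι) (δ ε : C.defectSpace) :
    inner ℂ (E.tuple.dilWord (i :: α) (E.defectIncl δ)) (E.defectIncl ε) = 0 := by
  refine C.denseRange_toDefect.induction_on
    (p := fun ε => inner ℂ (E.tuple.dilWord (i :: α) (E.defectIncl δ)) (E.defectIncl ε) = 0) ε
    (isClosed_eq (by fun_prop) (by fun_prop)) fun ξ => ?_
  rw [defectIncl_apply, wander_apply, inner_sub_right, inner_dilWord_defectIncl_inl, sub_zero]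
  set z := E.tuple.dilWord α (E.defectIncl δ) with hz
  have h1 : E.tuple.dilWord (i :: α) (E.defectIncl δ)
      = E.tuple.dilCol (single i z.fst) + inr (E.tuple.creation i z.snd) := rfl
  rw [h1, inner_add_left, RowContraction.inner_dilCol, RowContraction.inner_inr_creation_dilCol,
    add_zero]
  refine inner_push_eq_zero _ _ _ _ (fun k x => ?_) ξ
  have h2 : inner ℂ z (inl (E.embed x)) = inner ℂ z.fst (E.embed x) + inner ℂ z.snd 0 := rfl
  rw [hz, inner_dilWord_defectIncl_inl, ← hz, inner_zero_right, add_zero] at h2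
  by_cases hk : i = k
  · subst hk
    exact (LinearIsometry.inner_map_map _ _ _).trans h2.symm
  · exact inner_single_of_ne hk _ _

/-- The subspaces `V_α ℒ_C` are mutually orthogonal. -/
theorem orthogonalFamily (E : ContractiveLifting C) :
    OrthogonalFamily ℂ (fun _ : List ι => C.defectSpace)
      (fun α => (E.tuple.dilWord α).comp E.defectIncl) := by
  intro α β hαβ δ ε
  change inner ℂ (E.tuple.dilWord α (E.defectIncl δ)) (E.tuple.dilWord β (E.defectIncl ε)) = 0
  induction α generalizing β with
  | nil =>
    cases β with
    | nil => exact absurd rfl hαβ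
    | cons k β =>
      rw [← inner_conj_symm]
      exact (congrArg _ (E.inner_dilOp_wander k β ε δ)).trans (map_zero _)
  | cons i α ih =>
    cases β with
    | nil => exact E.inner_dilOp_wander i α δ ε
    | cons k β =>
      by_cases hk : i = k
      · subst hk
        refine ((E.tuple.dilOp i).inner_map_map _ _).trans (ih fun e => hαβ (e ▸ rfl))
      · exact E.tuple.inner_dilOpAux_of_ne hk _ _

/-- The canonical unitary `e_α ⊗ δ ↦ V_α δ` from `Γ ⊗ 𝒟_C` onto `⨁_α V_α ℒ_C`, where
`V = V^E` and `𝒟_C` is identified with `ℒ_C`. -/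
def fockIncl (E : ContractiveLifting C) : L2 (List ι) C.defectSpace →ₗᵢ[ℂ] E.tuple.DilSpace :=
  E.orthogonalFamily.linearIsometry

/-- The multi-analytic operator `M_{C,E} : Γ ⊗ 𝒟_E → Γ ⊗ 𝒟_C` of a contractive lifting: the
orthogonal projection onto `⨁_α V_α ℒ_C ≅ Γ ⊗ 𝒟_C` restricted to `Γ ⊗ 𝒟_E`, in the space
`H_E ⊕ (Γ ⊗ 𝒟_E)` of the minimal isometric dilation `V = V^E`. For minimal `E` it is the
characteristic function of the lifting. -/
def charFun (E : ContractiveLifting C) :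
    L2 (List ι) E.tuple.defectSpace →L[ℂ] L2 (List ι) C.defectSpace :=
  ContinuousLinearMap.adjoint E.fockIncl.toContinuousLinearMap ∘L inr.toContinuousLinearMap

/-- The symbol `Θ_{C,E} : 𝒟_E → Γ ⊗ 𝒟_C`, `δ ↦ M_{C,E} (e_∅ ⊗ δ)`. -/
def symbol (E : ContractiveLifting C) :
    E.tuple.defectSpace →L[ℂ] L2 (List ι) C.defectSpace :=
  E.charFun ∘L (single []).toContinuousLinearMap

end ContractiveLifting

/-- The minimal contractive liftings of `C`. -/
abbrev MinimalLifting {ι : Type} {H : Type u} [NormedAddCommGroup H] [InnerProductSpace ℂ H]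
    [CompleteSpace H] (C : RowContraction ι H) : Type (u + 1) :=
  {E : ContractiveLifting C // E.IsMinimal}

/-- Unitary equivalence on the minimal contractive liftings of `C`. -/
instance minimalLiftingSetoid {ι : Type} {H : Type u} [NormedAddCommGroup H]
    [InnerProductSpace ℂ H] [CompleteSpace H] (C : RowContraction ι H) :
    Setoid (MinimalLifting C) where
  r E E' := E.1.UnitarilyEquivalent E'.1
  iseqv :=
    { refl := fun E => ⟨LinearIsometryEquiv.refl ℂ _, fun _ _ => rfl, fun _ => rfl⟩
      symm := by
        rintro E E' ⟨U, h1, h2⟩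
        refine ⟨U.symm, fun i y => ?_, fun x => ?_⟩
        · rw [LinearIsometryEquiv.symm_apply_eq, h1, LinearIsometryEquiv.apply_symm_apply]
        · rw [LinearIsometryEquiv.symm_apply_eq, h2]
      trans := by
        rintro E E' E'' ⟨U, h1, h2⟩ ⟨U', h1', h2'⟩
        refine ⟨U.trans U', fun i y => ?_, fun x => ?_⟩
        · simp only [LinearIsometryEquiv.trans_apply, h1, h1']
        · simp only [LinearIsometryEquiv.trans_apply, h2, h2'] }

/-- The set of unitary equivalence classes of minimal contractive liftings of `C`. -/
abbrev MinimalLiftingClass {ι : Type} {H : Type u} [NormedAddCommGroup H]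
    [InnerProductSpace ℂ H] [CompleteSpace H] (C : RowContraction ι H) : Type (u + 1) :=
  Quotient (minimalLiftingSetoid C)

/-- Equivalence of the symbols of a lifting `E` of `C` and a lifting `E'` of `C'` when `𝒟_C` is
identified with `𝒟_{C'}` by the unitary `u`: there is a unitary `v : 𝒟_E → 𝒟_{E'}` with
`Θ_{C',E'} ∘ v = (1 ⊗ u) ∘ Θ_{C,E}`. -/
def SymbolsEquivalent {ι : Type} {H H' : Type u} [NormedAddCommGroup H] [InnerProductSpace ℂ H]
    [CompleteSpace H] [NormedAddCommGroup H'] [InnerProductSpace ℂ H'] [CompleteSpace H']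
    {C : RowContraction ι H} {C' : RowContraction ι H'}
    (u : C.defectSpace ≃ₗᵢ[ℂ] C'.defectSpace)
    (E : ContractiveLifting C) (E' : ContractiveLifting C') : Prop :=
  ∃ v : E.tuple.defectSpace ≃ₗᵢ[ℂ] E'.tuple.defectSpace,
    ∀ δ, E'.symbol (v δ) = push id Function.injective_id u.toLinearIsometry (E.symbol δ)

end

end RowLifting

/-! A minimal lifting `E` of `C` is encoded by the positive operator M M* on Γ ⊗ 𝒟_C, with M its
characteristic function. The dilation space H ⊕ (Γ ⊗ 𝒟_C) of `C` embeds in that of `E` compatibly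
with the two dilations (`dilIncl`). Compressing to H_E gives an operator T with T V_i = E_i T and
T*T = 1 − (0 ⊕ M M*), and `E` is minimal exactly when T has dense range (`isMinimal_iff`). Hence M
M* determines a minimal `E` up to unitary equivalence (`unitarilyEquivalent_iff`).

Conversely, let P be any contraction on Γ ⊗ 𝒟_C commuting with the adjoint creation operators. Let T
be the square root of 1 − (0 ⊕ P*P), taken into the closure of its range. Then E_i T = T V_i defines
a row contraction (`norm_map_dilRow`), and this is a minimal lifting whose M M* is P*P. The
conditions on P involve only 𝒟_C and not `C` itself, so P = M* can be carried over to `C'` by 1 ⊗ u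
(`exists_sameGram`). This gives the bijection.

Finally, M* commutes with the adjoint creation operators, so it is determined by its e_∅ coefficient
Θ*. By minimality Θ* has dense range, so equality of M M* amounts to equality of the symbols up to a
unitary of the defect spaces (`symbolsEquivalent_iff_sameGram`). -/

namespace RowLifting

noncomputable section

/-! ### Unitaries from dense ranges and from equal dimensions -/

section General

variable {X Y Z : Type u} [NormedAddCommGroup X] [InnerProductSpace ℂ X]
  [NormedAddCommGroup Y] [InnerProductSpace ℂ Y] [CompleteSpace Y]
  [NormedAddCommGroup Z] [InnerProductSpace ℂ Z] [CompleteSpace Z]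

/-- Two operators with dense ranges and equal norms differ by a unitary. -/
theorem exists_unitary_of_norm_eq (A : X →L[ℂ] Y) (B : X →L[ℂ] Z) (hA : DenseRange A)
    (hB : DenseRange B) (h : ∀ x, ‖A x‖ = ‖B x‖) :
    ∃ v : Y ≃ₗᵢ[ℂ] Z, ∀ x, v (A x) = B x := by
  have hAB : ∀ x, ‖B.toLinearMap x‖ ≤ 1 * ‖A.toLinearMap x‖ := fun x => by
    rw [one_mul]; exact (h x).ge
  let v : Y →L[ℂ] Z := B.toLinearMap.extendOfNorm A.toLinearMap
  have hv : ∀ x, v (A x) = B x := fun x =>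
    LinearMap.extendOfNorm_eq (f := B.toLinearMap) (e := A.toLinearMap) hA ⟨1, hAB⟩ x
  let v' : Y →ₗᵢ[ℂ] Z :=
    { toLinearMap := v.toLinearMap
      norm_map' := fun y => by
        refine hA.induction_on (p := fun y => ‖v y‖ = ‖y‖) y
          (isClosed_eq (by fun_prop) (by fun_prop)) fun x => ?_
        rw [hv, h] }
  have hsurj : Function.Surjective v' := by
    -- An isometry of a complete space has closed range; this one contains the dense range of `B`.
    have hcl : IsClosed (Set.range v') := v'.isometry.isClosedEmbedding.isClosed_range
    rw [← Set.range_eq_univ, ← hcl.closure_eq]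
    refine (hB.mono ?_).closure_eq
    rintro _ ⟨x, rfl⟩
    exact ⟨A x, hv x⟩
  exact ⟨LinearIsometryEquiv.ofSurjective v' hsurj, hv⟩

/-- Cardinals are well ordered, so the infimum is attained by some basis. Invariance of the
cardinality of a basis is therefore never needed. -/
theorem hilbertDim_eq_mk (G : Type u) [NormedAddCommGroup G] [InnerProductSpace ℂ G]
    [CompleteSpace G] :
    ∃ s : Set G, Nonempty (HilbertBasis s ℂ G) ∧ Cardinal.mk s = hilbertDim G := by
  obtain ⟨w, b, -⟩ := exists_hilbertBasis ℂ G
  exact csInf_mem (s := {c | ∃ s : Set G, Nonempty (HilbertBasis s ℂ G) ∧ Cardinal.mk s = c})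
    ⟨_, w, ⟨b⟩, rfl⟩

theorem nonempty_unitary_of_hilbertDim_eq (h : hilbertDim Y = hilbertDim Z) :
    Nonempty (Y ≃ₗᵢ[ℂ] Z) := by
  obtain ⟨s, ⟨b⟩, hs⟩ := hilbertDim_eq_mk Y
  obtain ⟨t, ⟨b'⟩, ht⟩ := hilbertDim_eq_mk Z
  obtain ⟨e⟩ := Cardinal.eq.1 (hs.trans (h.trans ht.symm))
  have ho : Orthonormal ℂ (b' ∘ e) := b'.orthonormal.comp e e.injective
  let b'' : HilbertBasis s ℂ Z := HilbertBasis.mk ho (by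
    rw [e.surjective.range_comp]
    exact b'.dense_span.ge)
  exact ⟨b.repr.trans b''.repr.symm⟩

end General

/-! ### Operators on Hilbert sums of copies of one space -/

section L2

theorem hasSum_norm_sq {κ : Type} {G : Type u} [NormedAddCommGroup G] (f : L2 κ G) :
    HasSum (fun k => ‖f k‖ ^ 2) (‖f‖ ^ 2) := by
  have h := lp.hasSum_norm (p := 2) (by norm_num) f
  simpa using h

variable {κ : Type} {G F : Type u} [NormedAddCommGroup G] [InnerProductSpace ℂ G]
  [NormedAddCommGroup F] [InnerProductSpace ℂ F]

theorem single_apply_self (k : κ) (x : G) : single k x k = x := by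
  classical
  exact lp.single_apply_self (E := fun _ : κ => G) 2 k x

theorem single_apply_of_ne {k l : κ} (h : l ≠ k) (x : G) : single k x l = 0 := by
  classical
  exact lp.single_apply_ne (E := fun _ : κ => G) 2 k x h

/-- A closed subspace of `ℓ²(κ; G)` containing all `e_k ⊗ x` is everything. -/
theorem mem_of_single_mem {S : Submodule ℂ (L2 κ G)} (hS : IsClosed (S : Set (L2 κ G)))
    (h : ∀ k x, single k x ∈ S) (f : L2 κ G) : f ∈ S :=
  hS.mem_of_tendsto (hasSum_single f) (Filter.Eventually.of_forall fun _ =>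
    S.sum_mem fun k _ => h k (f k))

theorem ext_single {F : Type*} [NormedAddCommGroup F] [NormedSpace ℂ F] {A B : L2 κ G →L[ℂ] F}
    (h : ∀ k x, A (single k x) = B (single k x))
    (f : L2 κ G) : A f = B f :=
  mem_of_single_mem (S := A.toLinearMap.eqLocus B.toLinearMap)
    (isClosed_eq A.continuous B.continuous) h f

theorem linearIsometry_single [CompleteSpace F] {V : κ → G →ₗᵢ[ℂ] F}
    (hV : OrthogonalFamily ℂ (fun _ : κ => G) V) (k : κ) (x : G) :
    hV.linearIsometry (single k x) = V k x := by
  classical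
  rw [single_eq]
  exact OrthogonalFamily.linearIsometry_apply_single (𝕜 := ℂ) (G := fun _ : κ => G) hV x

theorem memℓp_map (T : G →L[ℂ] F) (f : L2 κ G) : Memℓp (fun k => T (f k)) 2 := by
  refine memℓp_gen ?_
  have h := ((hasSum_norm_sq f).summable.mul_left (‖T‖ ^ 2))
  refine Summable.of_nonneg_of_le (fun k => by positivity) (fun k => ?_) h
  have h1 : ‖T (f k)‖ ≤ ‖T‖ * ‖f k‖ := T.le_opNorm _
  have h2 := pow_le_pow_left₀ (norm_nonneg _) h1 2
  rw [mul_pow] at h2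
  simpa using h2

/-- `1 ⊗ T` on `ℓ²(κ) ⊗ G`. -/
def mapL2 (T : G →L[ℂ] F) : L2 κ G →L[ℂ] L2 κ F :=
  LinearMap.mkContinuous
    { toFun := fun f => ⟨fun k => T (f k), memℓp_map T f⟩
      map_add' := fun f g => lp.ext (funext fun k => map_add T (f k) (g k))
      map_smul' := fun c f => lp.ext (funext fun k => map_smul T c (f k)) } ‖T‖ (fun f => by
    refine (sq_le_sq₀ (norm_nonneg _) (by positivity)).1 ?_
    rw [mul_pow]
    refine hasSum_le (fun k => ?_) (hasSum_norm_sq _) ((hasSum_norm_sq f).mul_left (‖T‖ ^ 2))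
    rw [← mul_pow]
    exact pow_le_pow_left₀ (norm_nonneg _) (T.le_opNorm (f k)) 2)

theorem mapL2_apply (T : G →L[ℂ] F) (f : L2 κ G) (k : κ) : mapL2 T f k = T (f k) := rfl

theorem mapL2_single (T : G →L[ℂ] F) (k : κ) (x : G) :
    mapL2 T (single k x) = single k (T x) := by
  refine lp.ext (funext fun l => ?_)
  rw [mapL2_apply]
  by_cases h : l = k
  · subst h; rw [single_apply_self, single_apply_self]
  · rw [single_apply_of_ne h, single_apply_of_ne h, map_zero]

/-- Needed to define a row operator on ⨁ K from its values on the vectors (T a_i). -/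
theorem denseRange_mapL2 (T : G →L[ℂ] F) (hT : DenseRange T) :
    DenseRange (mapL2 (κ := κ) T) := by
  intro f
  refine mem_of_single_mem (S := (mapL2 (κ := κ) T).range.topologicalClosure)
    (Submodule.isClosed_topologicalClosure _) (fun k x => ?_) f
  refine hT.induction_on (p := fun x => single k x ∈ (mapL2 (κ := κ) T).range.topologicalClosure) x
    ((Submodule.isClosed_topologicalClosure _).preimage (single k).continuous) fun y => ?_
  exact Submodule.le_topologicalClosure _ ⟨single k y, mapL2_single T k y⟩

theorem push_id_apply [CompleteSpace F] (f : G →ₗᵢ[ℂ] F) (g : L2 κ G) (k : κ) :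
    push id Function.injective_id f g k = f (g k) := by
  have h := ext_single (A := (push id Function.injective_id f).toContinuousLinearMap)
    (B := mapL2 f.toContinuousLinearMap) (fun l x => ?_) g
  · exact congrArg (fun z : L2 κ F => z k) h
  · rw [mapL2_single]
    exact push_single _ Function.injective_id _ _ _

/-- `1 ⊗ u` for a unitary `u`. -/
def mapEquiv [CompleteSpace G] [CompleteSpace F] (u : G ≃ₗᵢ[ℂ] F) : L2 κ G ≃ₗᵢ[ℂ] L2 κ F :=
  LinearIsometryEquiv.ofSurjective (push id Function.injective_id u.toLinearIsometry) fun g =>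
    ⟨push id Function.injective_id u.symm.toLinearIsometry g, lp.ext (funext fun k => by
      rw [push_id_apply, push_id_apply]; exact u.apply_symm_apply _)⟩

theorem mapEquiv_apply [CompleteSpace G] [CompleteSpace F] (u : G ≃ₗᵢ[ℂ] F) (g : L2 κ G)
    (k : κ) : mapEquiv u g k = u (g k) := push_id_apply _ _ _

end L2

/-! ### Adjoints of the creation operators -/

section Fock

theorem memℓp_shift {ι : Type} {G : Type u} [NormedAddCommGroup G] (i : ι)
    (f : L2 (List ι) G) : Memℓp (fun α => f (i :: α)) 2 := by
  refine memℓp_gen ?_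
  simpa [Function.comp_def] using
    (hasSum_norm_sq f).summable.comp_injective (List.cons_injective (a := i))

variable {ι : Type} {G F : Type u} [NormedAddCommGroup G] [InnerProductSpace ℂ G]
  [NormedAddCommGroup F] [InnerProductSpace ℂ F]

/-- The underlying linear map of `annihilation`. -/
def annihilationAux (i : ι) : L2 (List ι) G →ₗ[ℂ] L2 (List ι) G where
  toFun f := ⟨fun α => f (i :: α), memℓp_shift i f⟩
  map_add' _ _ := rfl
  map_smul' _ _ := rfl

theorem norm_annihilationAux_le (i : ι) (f : L2 (List ι) G) :
    ‖annihilationAux i f‖ ≤ 1 * ‖f‖ := by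
  rw [one_mul, ← sq_le_sq₀ (norm_nonneg _) (norm_nonneg _)]
  have h : HasSum (fun α => ‖f (i :: α)‖ ^ 2) (‖annihilationAux i f‖ ^ 2) :=
    hasSum_norm_sq (annihilationAux i f)
  have h' := hasSum_norm_sq f
  exact hasSum_le_inj (f := fun α => ‖f (i :: α)‖ ^ 2) (g := fun α => ‖f α‖ ^ 2)
    (fun α => i :: α) (List.cons_injective (a := i)) (fun c _ => sq_nonneg ‖f c‖)
    (fun α => le_refl (‖f (i :: α)‖ ^ 2)) h h'

/-- The adjoint `e_{iα} ⊗ x ↦ e_α ⊗ x` of the creation operator `L_i ⊗ 1`. -/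
def annihilation (i : ι) : L2 (List ι) G →L[ℂ] L2 (List ι) G :=
  (annihilationAux i).mkContinuous 1 (norm_annihilationAux_le i)

theorem annihilation_apply (i : ι) (f : L2 (List ι) G) (α : List ι) :
    annihilation i f α = f (i :: α) := rfl

theorem annihilation_single_nil (i : ι) (x : G) :
    annihilation i (single ([] : List ι) x) = 0 :=
  lp.ext (funext fun α => single_apply_of_ne (by simp) x)

theorem annihilation_single_cons (i : ι) (α : List ι) (x : G) :
    annihilation i (single (i :: α) x) = single α x := by
  refine lp.ext (funext fun β => ?_)
  rw [annihilation_apply]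
  by_cases h : β = α
  · subst h; rw [single_apply_self, single_apply_self]
  · rw [single_apply_of_ne h, single_apply_of_ne (by simpa using h)]

theorem annihilation_single_cons_of_ne {i j : ι} (h : i ≠ j) (α : List ι) (x : G) :
    annihilation i (single (j :: α) x) = 0 :=
  lp.ext (funext fun β => single_apply_of_ne (by simp [h]) x)

theorem annihilation_mapEquiv [CompleteSpace G] [CompleteSpace F] (u : G ≃ₗᵢ[ℂ] F) (i : ι)
    (g : L2 (List ι) G) : annihilation i (mapEquiv u g) = mapEquiv u (annihilation i g) :=
  lp.ext (funext fun α => by rw [annihilation_apply, mapEquiv_apply, mapEquiv_apply,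
    annihilation_apply])

/-- This is ∑ L_i L_i* = 1 − P_∅: every nonempty word is uniquely a letter followed by a word. -/
theorem hasSum_norm_annihilation (f : L2 (List ι) G) :
    HasSum (fun i => ‖annihilation i f‖ ^ 2) (‖f‖ ^ 2 - ‖f []‖ ^ 2) := by
  classical
  have h1 := hasSum_ite_sub_hasSum (hasSum_norm_sq f) []
  have hinj : Function.Injective fun p : ι × List ι => p.1 :: p.2 := fun p q h =>
    Prod.ext (List.cons.inj h).1 (List.cons.inj h).2
  have h3 : HasSum (fun p : ι × List ι => ‖f (p.1 :: p.2)‖ ^ 2) (‖f‖ ^ 2 - ‖f []‖ ^ 2) := by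
    rw [← hinj.hasSum_iff] at h1
    · simpa [Function.comp_def] using h1
    · rintro (_ | ⟨i, α⟩) h
      · simp
      · exact absurd ⟨(i, α), rfl⟩ h
  exact h3.prod_fiberwise fun i => hasSum_norm_sq (annihilation i f)

end Fock

/-! ### Minimality of the isometric dilation and its row isometry -/

namespace RowContraction

variable {ι : Type} {H : Type u} [NormedAddCommGroup H] [InnerProductSpace ℂ H] [CompleteSpace H]

theorem dilOp_inr (T : RowContraction ι H) (i : ι) (f : L2 (List ι) T.defectSpace) :
    T.dilOp i (inr f) = inr (T.creation i f) := by
  have h : T.dilOp i (inr f)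
      = T.dilCol (single i (inr f : T.DilSpace).fst) + inr (T.creation i f) := rfl
  rw [h, inr_fst, map_zero, map_zero, zero_add]

theorem dilOp_inl (T : RowContraction ι H) (i : ι) (x : H) :
    T.dilOp i (inl x) = T.dilCol (single i x) := by
  have h : T.dilOp i (inl x)
      = T.dilCol (single i x) + inr (T.creation i (inl x : T.DilSpace).snd) := rfl
  rw [h, inl_snd, map_zero, map_zero, add_zero]

theorem dilOp_snd (T : RowContraction ι H) (i : ι) (a : T.DilSpace) :
    (T.dilOp i a).snd
      = single [] (T.toDefect (single i a.fst)) + T.creation i a.snd := by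
  have h : (T.dilOp i a).snd
      = 0 + single [] (T.toDefect (single i a.fst)) + T.creation i a.snd := rfl
  rw [h, zero_add]

theorem dilOp_fst (T : RowContraction ι H) (i : ι) (a : T.DilSpace) :
    (T.dilOp i a).fst = T.op i a.fst := by
  have h : (T.dilOp i a).fst = T.op i a.fst + 0 + 0 := rfl
  rw [h, add_zero, add_zero]

theorem creation_single (T : RowContraction ι H) (i : ι) (α : List ι) (δ : T.defectSpace) :
    T.creation i (single α δ) = single (i :: α) δ :=
  push_single _ _ _ _ _

theorem eq_inl_add_inr (T : RowContraction ι H) (a : T.DilSpace) :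
    a = inl a.fst + inr a.snd := by
  have h : (inl a.fst + inr a.snd : T.DilSpace) = WithLp.toLp 2 (a.fst + 0, 0 + a.snd) := rfl
  rw [h, add_zero, zero_add]
  rfl

/-- The canonical isometric dilation is minimal: a closed subspace that contains `H` and is
invariant under the dilation is the whole space. -/
theorem mem_of_invariant (T : RowContraction ι H) {S : Submodule ℂ T.DilSpace}
    (hS : IsClosed (S : Set T.DilSpace)) (hinl : ∀ x, inl x ∈ S)
    (hinv : ∀ i, ∀ a ∈ S, T.dilOp i a ∈ S) (a : T.DilSpace) : a ∈ S := by
  have hcol : ∀ ξ, T.dilCol ξ ∈ S := fun ξ =>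
    mem_of_single_mem (S := S.comap T.dilCol.toLinearMap) (hS.preimage T.dilCol.continuous)
      (fun k x => by
        have h := hinv k _ (hinl x)
        rwa [dilOp_inl] at h) ξ
  have hdef : ∀ δ, inr (single [] δ) ∈ S := fun δ => by
    refine T.denseRange_toDefect.induction_on (p := fun δ => inr (single [] δ) ∈ S) δ
      (hS.preimage (inr.continuous.comp (single []).continuous)) fun ξ => ?_
    -- The vacuum copy of the defect space is reached because ∑ V_i ξ_i differs from e_∅ ⊗ D_T ξ
    -- only by a vector of H.
    have h : (inr (single [] (T.toDefect ξ)) : T.DilSpace) = T.dilCol ξ - inl (T.row ξ) := by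
      rw [dilCol_apply, add_sub_cancel_left]
    rw [h]
    exact S.sub_mem (hcol ξ) (hinl _)
  have hword : ∀ α δ, inr (single α δ) ∈ S := fun α => by
    induction α with
    | nil => exact hdef
    | cons i α ih =>
      intro δ
      rw [← creation_single, ← dilOp_inr]
      exact hinv i _ (ih δ)
  have hinr : ∀ f, inr f ∈ S := fun f =>
    mem_of_single_mem (S := S.comap (inr : _ →ₗᵢ[ℂ] T.DilSpace).toLinearMap)
      (hS.preimage inr.continuous) hword f
  rw [T.eq_inl_add_inr a]
  exact S.add_mem (hinl _) (hinr _)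

theorem orthogonalFamily_dilOp (T : RowContraction ι H) :
    OrthogonalFamily ℂ (fun _ : ι => T.DilSpace) T.dilOp :=
  fun _ _ h a b => T.inner_dilOpAux_of_ne h a b

/-- The row isometry `(a_i) ↦ ∑ i, V_i a_i`. -/
def dilRow (T : RowContraction ι H) : L2 ι T.DilSpace →ₗᵢ[ℂ] T.DilSpace :=
  T.orthogonalFamily_dilOp.linearIsometry

theorem dilRow_single (T : RowContraction ι H) (i : ι) (a : T.DilSpace) :
    T.dilRow (single i a) = T.dilOp i a :=
  linearIsometry_single T.orthogonalFamily_dilOp i a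

theorem annihilation_creation (T : RowContraction ι H) (i : ι) (f : L2 (List ι) T.defectSpace) :
    annihilation i (T.creation i f) = f := by
  refine ext_single (A := annihilation i ∘L (T.creation i).toContinuousLinearMap)
    (B := ContinuousLinearMap.id ℂ _) (fun α δ => ?_) f
  have h : annihilation i (T.creation i (single α δ)) = single α δ := by
    rw [creation_single, annihilation_single_cons]
  exact h

theorem annihilation_creation_of_ne (T : RowContraction ι H) {i j : ι} (hij : i ≠ j)
    (f : L2 (List ι) T.defectSpace) : annihilation i (T.creation j f) = 0 := by
  refine ext_single (A := annihilation i ∘L (T.creation j).toContinuousLinearMap)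
    (B := 0) (fun α δ => ?_) f
  have h : annihilation i (T.creation j (single α δ)) = 0 := by
    rw [creation_single, annihilation_single_cons_of_ne hij]
  exact h

theorem annihilation_dilOp (T : RowContraction ι H) (i : ι) (a : T.DilSpace) :
    annihilation i (T.dilOp i a).snd = a.snd := by
  rw [dilOp_snd, map_add, annihilation_single_nil, annihilation_creation, zero_add]

theorem annihilation_dilOp_of_ne (T : RowContraction ι H) {i j : ι} (hij : i ≠ j)
    (a : T.DilSpace) : annihilation i (T.dilOp j a).snd = 0 := by
  rw [dilOp_snd, map_add, annihilation_single_nil, annihilation_creation_of_ne T hij, zero_add]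

/-- The defect terms of ∑ V_j a_j lie over e_∅ and are killed by L_i*, while L_i* L_j = δ_ij selects
the Fock component of a_i. -/
theorem annihilation_dilRow (T : RowContraction ι H) (i : ι) (a : L2 ι T.DilSpace) :
    annihilation i (T.dilRow a).snd = (a i).snd := by
  refine ext_single
    (A := annihilation i ∘L WithLp.sndL 2 ℂ H _ ∘L T.dilRow.toContinuousLinearMap)
    (B := WithLp.sndL 2 ℂ H _ ∘L lp.evalCLM ℂ (fun _ : ι => T.DilSpace) 2 i)
    (fun k x => ?_) a
  have h : annihilation i (T.dilRow (single k x)).snd = (single k x i : T.DilSpace).snd := by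
    rw [dilRow_single]
    by_cases hk : i = k
    · subst hk
      rw [annihilation_dilOp, single_apply_self]
    · rw [annihilation_dilOp_of_ne T hk, single_apply_of_ne hk]
      rfl
  exact h

end RowContraction

/-! ### The dilation of `C` inside that of `E`, and its compression to H_E -/

namespace ContractiveLifting

variable {ι : Type} {H : Type u} [NormedAddCommGroup H] [InnerProductSpace ℂ H] [CompleteSpace H]
  {C : RowContraction ι H}

theorem fockIncl_single (E : ContractiveLifting C) (α : List ι) (δ : C.defectSpace) :
    E.fockIncl (single α δ) = E.tuple.dilWord α (E.defectIncl δ) :=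
  linearIsometry_single E.orthogonalFamily α δ

theorem inner_inl_fockIncl (E : ContractiveLifting C) (h : H) (g : L2 (List ι) C.defectSpace) :
    inner ℂ (inl (E.embed h)) (E.fockIncl g) = 0 := by
  refine ext_single (A := innerSL ℂ (inl (E.embed h) : E.tuple.DilSpace) ∘L E.fockIncl.toContinuousLinearMap)
    (B := 0) (fun α δ => ?_) g
  have h : inner ℂ (inl (E.embed h)) (E.fockIncl (single α δ)) = 0 := by
    rw [fockIncl_single, ← inner_conj_symm, inner_dilWord_defectIncl_inl, map_zero]
  exact h

theorem fockIncl_creation (E : ContractiveLifting C) (i : ι) (g : L2 (List ι) C.defectSpace) :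
    E.fockIncl (C.creation i g) = E.tuple.dilOp i (E.fockIncl g) := by
  refine ext_single
    (A := E.fockIncl.toContinuousLinearMap ∘L (C.creation i).toContinuousLinearMap)
    (B := (E.tuple.dilOp i).toContinuousLinearMap ∘L E.fockIncl.toContinuousLinearMap)
    (fun α δ => ?_) g
  have h : E.fockIncl (C.creation i (single α δ))
      = E.tuple.dilOp i (E.fockIncl (single α δ)) := by
    rw [RowContraction.creation_single, fockIncl_single, fockIncl_single]
    rfl
  exact h

/-- The canonical embedding of the minimal isometric dilation space of `C` into that of `E`. -/
def dilIncl (E : ContractiveLifting C) : C.DilSpace →L[ℂ] E.tuple.DilSpace :=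
  (inl.comp E.embed).toContinuousLinearMap ∘L WithLp.fstL 2 ℂ _ _ +
    E.fockIncl.toContinuousLinearMap ∘L WithLp.sndL 2 ℂ _ _

theorem dilIncl_apply (E : ContractiveLifting C) (a : C.DilSpace) :
    E.dilIncl a = inl (E.embed a.fst) + E.fockIncl a.snd := rfl

/-- H is orthogonal to every V_α ℒ_C, so the two isometric pieces add up by Pythagoras. -/
theorem norm_dilIncl (E : ContractiveLifting C) (a : C.DilSpace) : ‖E.dilIncl a‖ = ‖a‖ := by
  refine (sq_eq_sq₀ (norm_nonneg _) (norm_nonneg _)).1 ?_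
  have h := norm_add_sq_eq_norm_sq_add_norm_sq_of_inner_eq_zero (𝕜 := ℂ) _ _
    (E.inner_inl_fockIncl a.fst a.snd)
  rw [dilIncl_apply, WithLp.prod_norm_sq_eq_of_L2 a, sq, h, LinearIsometry.norm_map,
    LinearIsometry.norm_map, LinearIsometry.norm_map, sq, sq]

/-- The defect vector D_C(e_i ⊗ x) is sent to (V_i − C_i)x, so the terms C_i x cancel and V_i x
remains. On Γ ⊗ 𝒟_C the map intertwines by construction. -/
theorem dilIncl_dilOp (E : ContractiveLifting C) (i : ι) (a : C.DilSpace) :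
    E.dilIncl (C.dilOp i a) = E.tuple.dilOp i (E.dilIncl a) := by
  have h1 : E.embedSum (single i a.fst) = single i (E.embed a.fst) := push_single _ _ _ _ _
  have h2 : E.fockIncl (single [] (C.toDefect (single i a.fst)))
      = E.tuple.dilCol (single i (E.embed a.fst)) - inl (E.embed (C.op i a.fst)) := by
    rw [fockIncl_single, ← h1]
    exact E.defectIncl_apply _
  rw [dilIncl_apply, dilIncl_apply, C.dilOp_fst, C.dilOp_snd, map_add E.fockIncl, h2,
    fockIncl_creation, map_add, RowContraction.dilOp_inl]
  abel

/-- The compression `a ↦ P_{H_E} a` to `H_E` of the minimal isometric dilation space of `C`, seen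
inside that of `E`. -/
def compression (E : ContractiveLifting C) : C.DilSpace →L[ℂ] E.space :=
  WithLp.fstL 2 ℂ _ _ ∘L E.dilIncl

theorem compression_apply (E : ContractiveLifting C) (a : C.DilSpace) :
    E.compression a = (E.dilIncl a).fst := rfl

/-- The adjoint of `charFun`: the component in `Γ ⊗ 𝒟_E` of an element of `Γ ⊗ 𝒟_C`. -/
def charAdj (E : ContractiveLifting C) :
    L2 (List ι) C.defectSpace →L[ℂ] L2 (List ι) E.tuple.defectSpace :=
  WithLp.sndL 2 ℂ _ _ ∘L E.fockIncl.toContinuousLinearMap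

theorem charAdj_apply (E : ContractiveLifting C) (g : L2 (List ι) C.defectSpace) :
    E.charAdj g = (E.fockIncl g).snd := rfl

theorem dilIncl_snd (E : ContractiveLifting C) (a : C.DilSpace) :
    (E.dilIncl a).snd = E.charAdj a.snd := by
  have h : (E.dilIncl a).snd = 0 + E.charAdj a.snd := rfl
  rw [h, zero_add]

theorem norm_charAdj_le (E : ContractiveLifting C) (g : L2 (List ι) C.defectSpace) :
    ‖E.charAdj g‖ ≤ ‖g‖ :=
  (WithLp.norm_snd_le _ (E.fockIncl g)).trans_eq (E.fockIncl.norm_map g)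

/-- The identity T*T = 1 − (0 ⊕ M M*): the part of the isometric image of a outside H_E is M*
applied to its Fock component. -/
theorem norm_compression_sq (E : ContractiveLifting C) (a : C.DilSpace) :
    ‖E.compression a‖ ^ 2 = ‖a‖ ^ 2 - ‖E.charAdj a.snd‖ ^ 2 := by
  rw [← E.norm_dilIncl a, WithLp.prod_norm_sq_eq_of_L2 (E.dilIncl a), dilIncl_snd,
    compression_apply, add_sub_cancel_right]

theorem compression_inl (E : ContractiveLifting C) (h : H) :
    E.compression (inl h) = E.embed h := by
  have h1 : E.compression (inl h)
      = E.embed h + (E.fockIncl (inl h : C.DilSpace).snd).fst := rfl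
  rw [h1, inl_snd, map_zero]
  exact add_zero _

theorem compression_dilOp (E : ContractiveLifting C) (i : ι) (a : C.DilSpace) :
    E.compression (C.dilOp i a) = E.tuple.op i (E.compression a) := by
  rw [compression_apply, dilIncl_dilOp, RowContraction.dilOp_fst, compression_apply]

/-- The compression is determined by its restriction to `H` and the intertwining relations. -/
theorem eq_compression (E : ContractiveLifting C) (T : C.DilSpace →L[ℂ] E.space)
    (hinl : ∀ h, T (inl h) = E.embed h)
    (hT : ∀ i a, T (C.dilOp i a) = E.tuple.op i (T a)) (a : C.DilSpace) :
    T a = E.compression a := by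
  refine C.mem_of_invariant (S := T.toLinearMap.eqLocus E.compression.toLinearMap)
    (isClosed_eq T.continuous E.compression.continuous) (fun h => ?_) (fun i b hb => ?_) a
  · exact (hinl h).trans (E.compression_inl h).symm
  · refine (hT i b).trans (Eq.trans ?_ (E.compression_dilOp i b).symm)
    exact congrArg (E.tuple.op i) hb

/-- Since T V_i = E_i T and T is the inclusion on H, the range of T contains every E_α x.
Conversely, minimality of the dilation of `C` keeps that range within their closed span. -/
theorem isMinimal_iff (E : ContractiveLifting C) : E.IsMinimal ↔ DenseRange E.compression := by
  constructor
  · intro h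
    have hle : Submodule.span ℂ {y : E.space | ∃ (α : List ι) (x : H),
        y = E.tuple.wordOp α (E.embed x)} ≤ E.compression.range := by
      refine Submodule.span_le.2 ?_
      rintro _ ⟨α, x, rfl⟩
      induction α with
      | nil => exact ⟨inl x, E.compression_inl x⟩
      | cons i α ih =>
        obtain ⟨b, hb⟩ := ih
        refine ⟨C.dilOp i b, (E.compression_dilOp i b).trans ?_⟩
        exact congrArg (E.tuple.op i) hb
    have htop := Submodule.topologicalClosure_mono hle
    rw [show (Submodule.span ℂ _).topologicalClosure = ⊤ from h] at htop
    exact fun y => htop (Submodule.mem_top (x := y))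
  · intro h
    set S := Submodule.span ℂ {y : E.space | ∃ (α : List ι) (x : H),
      y = E.tuple.wordOp α (E.embed x)} with hS
    have hinv : ∀ i, ∀ y ∈ S.topologicalClosure, E.tuple.op i y ∈ S.topologicalClosure := by
      intro i
      have h1 : S ≤ S.comap (E.tuple.op i).toLinearMap := by
        refine Submodule.span_le.2 ?_
        rintro _ ⟨α, x, rfl⟩
        exact Submodule.subset_span ⟨i :: α, x, rfl⟩
      have h2 : S.topologicalClosure
          ≤ S.topologicalClosure.comap (E.tuple.op i).toLinearMap :=
        S.topologicalClosure_minimal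
          (h1.trans (Submodule.comap_mono S.le_topologicalClosure))
          (S.isClosed_topologicalClosure.preimage (E.tuple.op i).continuous)
      exact h2
    have hmem : ∀ a, E.compression a ∈ S.topologicalClosure := fun a => by
      refine C.mem_of_invariant (S := S.topologicalClosure.comap E.compression.toLinearMap)
        (S.isClosed_topologicalClosure.preimage E.compression.continuous) (fun x => ?_)
        (fun i b hb => ?_) a
      · have : E.compression (inl x) ∈ S.topologicalClosure := by
          rw [compression_inl]
          exact S.le_topologicalClosure (Submodule.subset_span ⟨[], x, rfl⟩)
        exact this
      · have : E.compression (C.dilOp i b) ∈ S.topologicalClosure := by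
          rw [compression_dilOp]
          exact hinv i _ hb
        exact this
    refine eq_top_iff.2 fun y _ => ?_
    exact h.induction_on (p := fun y => y ∈ S.topologicalClosure) y S.isClosed_topologicalClosure
      hmem

/-- The adjoint form of M (L_i ⊗ 1) = (L_i ⊗ 1) M. On nonempty words it follows from the
intertwining of the dilations; on the empty word both sides vanish. -/
theorem annihilation_charAdj (E : ContractiveLifting C) (i : ι)
    (g : L2 (List ι) C.defectSpace) :
    annihilation i (E.charAdj g) = E.charAdj (annihilation i g) := by
  have hcons : ∀ j α δ, E.charAdj (single (j :: α) δ)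
      = (E.tuple.dilOp j (E.fockIncl (single α δ))).snd := fun j α δ => by
    rw [← RowContraction.creation_single, charAdj_apply, fockIncl_creation]
  refine ext_single (A := annihilation i ∘L E.charAdj) (B := E.charAdj ∘L annihilation i)
    (fun α δ => ?_) g
  have h : annihilation i (E.charAdj (single α δ)) = E.charAdj (annihilation i (single α δ)) := by
    cases α with
    | nil =>
      rw [annihilation_single_nil, map_zero]
      have hc : Continuous fun δ => annihilation i (E.charAdj (single [] δ)) :=
        (annihilation i).continuous.comp (E.charAdj.continuous.comp (single []).continuous)
      refine C.denseRange_toDefect.induction_on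
        (p := fun δ => annihilation i (E.charAdj (single [] δ)) = 0) δ
        (isClosed_eq hc continuous_const) fun ξ => ?_
      -- The Fock component of ∑ (V_i − C_i) ξ_i lies over e_∅.
      have h1 : E.charAdj (single [] (C.toDefect ξ))
          = 0 + single [] (E.tuple.toDefect (E.embedSum ξ)) - 0 := by
        rw [charAdj_apply, fockIncl_single]
        exact congrArg WithLp.snd (E.defectIncl_apply ξ)
      rw [h1, sub_zero, zero_add, annihilation_single_nil]
    | cons j α =>
      rw [hcons]
      by_cases hij : i = j
      · subst hij
        rw [annihilation_single_cons, RowContraction.annihilation_dilOp, charAdj_apply]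
      · rw [annihilation_single_cons_of_ne hij, map_zero,
          RowContraction.annihilation_dilOp_of_ne _ hij]
  exact h

/-- The adjoint of the symbol. -/
def symbolAdj (E : ContractiveLifting C) :
    L2 (List ι) C.defectSpace →L[ℂ] E.tuple.defectSpace :=
  lp.evalCLM ℂ (fun _ : List ι => E.tuple.defectSpace) 2 [] ∘L E.charAdj

theorem symbolAdj_apply (E : ContractiveLifting C) (g : L2 (List ι) C.defectSpace) :
    E.symbolAdj g = E.charAdj g [] := rfl

theorem inner_symbol (E : ContractiveLifting C) (δ : E.tuple.defectSpace)
    (g : L2 (List ι) C.defectSpace) :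
    inner ℂ (E.symbol δ) g = inner ℂ δ (E.symbolAdj g) := by
  have h1 : E.symbol δ = ContinuousLinearMap.adjoint E.fockIncl.toContinuousLinearMap
      (inr (single [] δ)) := rfl
  rw [h1, ContinuousLinearMap.adjoint_inner_left, WithLp.prod_inner_apply]
  have h2 : inner ℂ (0 : E.space) (E.fockIncl g).fst
      + inner ℂ (single [] δ) (E.charAdj g) = inner ℂ δ (E.symbolAdj g) := by
    rw [inner_zero_left, zero_add, inner_single_left, symbolAdj_apply]
  exact h2

/-- The e_∅ coefficient of V_i applied to the embedded vector comes only from the defect term, as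
creation operators produce no e_∅ component. -/
theorem symbolAdj_dilOp (E : ContractiveLifting C) (i : ι) (a : C.DilSpace) :
    E.symbolAdj (C.dilOp i a).snd = E.tuple.toDefect (single i (E.compression a)) := by
  have h : E.tuple.creation i (E.dilIncl a).snd [] = 0 := by
    refine ext_inner_left ℂ fun δ => ?_
    rw [← inner_single_left, RowContraction.inner_single_creation, inner_zero_right]
  have h2 : (single [] (E.tuple.toDefect (single i (E.compression a)))
      + E.tuple.creation i (E.dilIncl a).snd : L2 (List ι) _) []
      = single ([] : List ι) (E.tuple.toDefect (single i (E.compression a))) []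
        + E.tuple.creation i (E.dilIncl a).snd [] := rfl
  rw [symbolAdj_apply, ← dilIncl_snd, dilIncl_dilOp, RowContraction.dilOp_snd,
    ← compression_apply, h2, h, single_apply_self, add_zero]

/-- The range contains all D_E(e_i ⊗ T a). By minimality the vectors T a are dense in H_E, so these
span a dense subspace of 𝒟_E. -/
theorem denseRange_symbolAdj (E : ContractiveLifting C) (hE : E.IsMinimal) :
    DenseRange E.symbolAdj := by
  have hT := (isMinimal_iff E).1 hE
  have hcl := E.symbolAdj.range.isClosed_topologicalClosure
  have h1 : ∀ ξ, E.tuple.toDefect ξ ∈ E.symbolAdj.range.topologicalClosure := fun ξ => by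
    refine mem_of_single_mem
      (S := E.symbolAdj.range.topologicalClosure.comap E.tuple.toDefect.toLinearMap)
      (hcl.preimage E.tuple.toDefect.continuous) (fun i y => ?_) ξ
    refine hT.induction_on
      (p := fun y => E.tuple.toDefect (single i y) ∈ E.symbolAdj.range.topologicalClosure) y
      (hcl.preimage (E.tuple.toDefect.continuous.comp (single i).continuous)) fun a => ?_
    rw [← symbolAdj_dilOp]
    exact Submodule.le_topologicalClosure _ ⟨_, rfl⟩
  exact fun δ => E.tuple.denseRange_toDefect.induction_on
    (p := fun δ => δ ∈ E.symbolAdj.range.topologicalClosure) δ hcl h1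

end ContractiveLifting

/-! ### Building a minimal lifting from a contraction commuting with the adjoint creations -/

namespace RowContraction

variable {ι : Type} {H : Type u} [NormedAddCommGroup H] [InnerProductSpace ℂ H] [CompleteSpace H]

/-- `T : H ⊕ (Γ ⊗ 𝒟_C) → K` has dense range and Gram operator `1 - (0 ⊕ P* P)`, where the
contraction `P` commutes with the adjoints of the creation operators. -/
structure IsModel (C : RowContraction ι H) {F K : Type u}
    [NormedAddCommGroup F] [InnerProductSpace ℂ F] [NormedAddCommGroup K] [InnerProductSpace ℂ K]
    (P : L2 (List ι) C.defectSpace →L[ℂ] L2 (List ι) F) (T : C.DilSpace →L[ℂ] K) : Prop where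
  dense : DenseRange T
  inner_map_map : ∀ a b, inner ℂ (T a) (T b) = inner ℂ a b - inner ℂ (P a.snd) (P b.snd)
  annihilation_map : ∀ i g, annihilation i (P g) = P (annihilation i g)

/-- Take the square root of 1 − Q*Q, where Q is P on the Fock summand and 0 on H, as a map into the
closure of its range. -/
theorem exists_isModel (C : RowContraction ι H) {F : Type u}
    [NormedAddCommGroup F] [InnerProductSpace ℂ F] [CompleteSpace F]
    (P : L2 (List ι) C.defectSpace →L[ℂ] L2 (List ι) F) (hP : ∀ g, ‖P g‖ ≤ ‖g‖)
    (hS : ∀ i g, annihilation i (P g) = P (annihilation i g)) :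
    ∃ (K : Type u) (_ : NormedAddCommGroup K) (_ : InnerProductSpace ℂ K) (_ : CompleteSpace K)
      (T : C.DilSpace →L[ℂ] K), C.IsModel P T := by
  let Q : C.DilSpace →L[ℂ] L2 (List ι) F := P ∘L WithLp.sndL 2 ℂ _ _
  have hQ : ‖Q‖ ≤ 1 := Q.opNorm_le_bound zero_le_one fun a => by
    rw [one_mul]
    exact (hP a.snd).trans (WithLp.norm_snd_le _ a)
  let R : C.DilSpace →L[ℂ] C.DilSpace := opSqrt (1 - ContinuousLinearMap.adjoint Q ∘L Q)
  have hR : ∀ a b, inner ℂ (R a) (R b) = inner ℂ a b - inner ℂ (Q a) (Q b) := fun a b => by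
    rw [inner_opSqrt _ (one_sub_adjoint_nonneg Q hQ), ← ContinuousLinearMap.adjoint_inner_right,
      ← inner_sub_right]
    rfl
  let T : C.DilSpace →L[ℂ] R.range.topologicalClosure :=
    R.codRestrict _ fun x => Submodule.le_topologicalClosure _ ⟨x, rfl⟩
  refine ⟨R.range.topologicalClosure, inferInstance, inferInstance,
    R.range.isClosed_topologicalClosure.completeSpace_coe, T, ?_, hR, hS⟩
  have hset : Set.range (Subtype.val ∘ T) = (R.range : Set C.DilSpace) := rfl
  intro y
  rw [closure_subtype, ← Set.range_comp, hset]
  exact y.2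

namespace IsModel

variable {C : RowContraction ι H} {F K : Type u} [NormedAddCommGroup F] [InnerProductSpace ℂ F]
  [NormedAddCommGroup K] [InnerProductSpace ℂ K]
  {P : L2 (List ι) C.defectSpace →L[ℂ] L2 (List ι) F} {T : C.DilSpace →L[ℂ] K}

theorem norm_map_sq (h : C.IsModel P T) (a : C.DilSpace) :
    ‖T a‖ ^ 2 = ‖a‖ ^ 2 - ‖P a.snd‖ ^ 2 := by
  rw [norm_sq_eq_re_inner (𝕜 := ℂ) (T a), norm_sq_eq_re_inner (𝕜 := ℂ) a,
    norm_sq_eq_re_inner (𝕜 := ℂ) (P a.snd), h.inner_map_map, map_sub]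

theorem inner_map_inl (h : C.IsModel P T) (a : C.DilSpace) (x : H) :
    inner ℂ (T a) (T (inl x)) = inner ℂ a.fst x := by
  rw [h.inner_map_map, inl_snd, map_zero, inner_zero_right, sub_zero, WithLp.prod_inner_apply]
  have h1 : inner ℂ a.fst x + inner ℂ a.snd 0 = inner ℂ a.fst x := by
    rw [inner_zero_right, add_zero]
  exact h1

/-- Put f = P(∑ V_i a_i). Then ‖T ∑ V_i a_i‖² = ∑ ‖a_i‖² − ‖f‖². Since L_i* f = P a_i on Fock
components, this equals ∑ ‖T a_i‖² − ‖f_∅‖². Thus T a ↦ T V a is a well-defined row contraction. -/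
theorem norm_map_dilRow (h : C.IsModel P T) (a : L2 ι C.DilSpace) :
    ‖T (C.dilRow a)‖ ≤ 1 * ‖mapL2 T a‖ := by
  rw [one_mul, ← sq_le_sq₀ (norm_nonneg _) (norm_nonneg _)]
  have h1 := (hasSum_norm_sq a).sub (hasSum_norm_annihilation (P (C.dilRow a).snd))
  have h2 : HasSum (fun i => ‖T (a i)‖ ^ 2) (‖mapL2 T a‖ ^ 2) := hasSum_norm_sq (mapL2 T a)
  have h3 : (fun i => ‖a i‖ ^ 2 - ‖annihilation i (P (C.dilRow a).snd)‖ ^ 2)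
      = fun i => ‖T (a i)‖ ^ 2 := funext fun i => by
    rw [h.annihilation_map, C.annihilation_dilRow, h.norm_map_sq]
  rw [h3] at h1
  rw [h2.unique h1, h.norm_map_sq, LinearIsometry.norm_map]
  linarith [sq_nonneg ‖P (C.dilRow a).snd []‖]

/-- The inclusion of `H` into `K`. -/
def embed (h : C.IsModel P T) : H →ₗᵢ[ℂ] K where
  toLinearMap := T.toLinearMap ∘ₗ (inl : H →ₗᵢ[ℂ] C.DilSpace).toLinearMap
  norm_map' x := by
    refine (sq_eq_sq₀ (norm_nonneg _) (norm_nonneg _)).1 ?_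
    refine (h.norm_map_sq (inl x)).trans ?_
    rw [inl_snd, map_zero, norm_zero, LinearIsometry.norm_map]
    ring

theorem embed_apply (h : C.IsModel P T) (x : H) : h.embed x = T (inl x) := rfl

variable [CompleteSpace K]

/-- The row contraction on `K` with `E_i T = T V_i`. -/
def tuple (h : C.IsModel P T) : RowContraction ι K where
  row := (T ∘L C.dilRow.toContinuousLinearMap).toLinearMap.extendOfNorm (mapL2 T).toLinearMap
  norm_row_le := LinearMap.opNorm_extendOfNorm_le (denseRange_mapL2 T h.dense) zero_le_one
    h.norm_map_dilRow

theorem op_map (h : C.IsModel P T) (i : ι) (a : C.DilSpace) :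
    h.tuple.op i (T a) = T (C.dilOp i a) := by
  have h1 : h.tuple.row (mapL2 T (single i a)) = T (C.dilRow (single i a)) :=
    LinearMap.extendOfNorm_eq (f := (T ∘L C.dilRow.toContinuousLinearMap).toLinearMap)
      (e := (mapL2 T).toLinearMap) (denseRange_mapL2 T h.dense) ⟨1, h.norm_map_dilRow⟩ _
  rw [mapL2_single, dilRow_single] at h1
  exact h1

/-- Says E_i* restricts to C_i* on H, which is equivalent to the lower triangular block form and
yields both lifting axioms. -/
theorem inner_op_embed (h : C.IsModel P T) (i : ι) (y : K) (x : H) :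
    inner ℂ (h.tuple.op i y) (h.embed x)
      = inner ℂ y (h.embed (ContinuousLinearMap.adjoint (C.op i) x)) := by
  refine h.dense.induction_on (p := fun y => inner ℂ (h.tuple.op i y) (h.embed x)
      = inner ℂ y (h.embed (ContinuousLinearMap.adjoint (C.op i) x))) y
    (isClosed_eq (by fun_prop) (by fun_prop)) fun a => ?_
  rw [op_map, embed_apply, embed_apply, h.inner_map_inl, h.inner_map_inl, dilOp_fst,
    ContinuousLinearMap.adjoint_inner_right]

/-- The contractive lifting on `K`. -/
def lifting (h : C.IsModel P T) : ContractiveLifting C where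
  space := K
  embed := h.embed
  tuple := h.tuple
  compress i x := by
    refine ext_inner_right ℂ fun y => ?_
    rw [ContinuousLinearMap.adjoint_inner_left]
    refine (h.inner_op_embed i _ _).trans ?_
    rw [LinearIsometry.inner_map_map, ContinuousLinearMap.adjoint_inner_right]
  lower i y hy := by
    refine ext_inner_right ℂ fun x => ?_
    rw [ContinuousLinearMap.adjoint_inner_left]
    refine (h.inner_op_embed i _ _).trans ?_
    refine (ContinuousLinearMap.adjoint_inner_left h.embed.toContinuousLinearMap _ _).symm.trans ?_
    rw [hy, inner_zero_left, inner_zero_left]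

theorem compression_lifting (h : C.IsModel P T) (a : C.DilSpace) :
    h.lifting.compression a = T a :=
  (h.lifting.eq_compression T (fun _ => rfl) (fun i b => (h.op_map i b).symm) a).symm

theorem isMinimal_lifting (h : C.IsModel P T) : h.lifting.IsMinimal :=
  h.lifting.isMinimal_iff.2 <| by
    rw [show ⇑h.lifting.compression = ⇑T from funext h.compression_lifting]
    exact h.dense

/-- T is the compression of the lifting, so both ‖g‖² − ‖M* g‖² and ‖g‖² − ‖P g‖² compute ‖T(0 ⊕
g)‖². -/
theorem norm_charAdj_lifting (h : C.IsModel P T) (g : L2 (List ι) C.defectSpace) :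
    ‖h.lifting.charAdj g‖ = ‖P g‖ := by
  have h1 := h.lifting.norm_compression_sq (inr g)
  rw [h.compression_lifting] at h1
  have h2 := (h.norm_map_sq (inr g)).symm.trans h1
  rw [inr_snd] at h2
  refine (sq_eq_sq₀ (norm_nonneg _) (norm_nonneg _)).1 ?_
  linarith

end IsModel

end RowContraction

/-! ### Comparing liftings through M M* -/

namespace ContractiveLifting

variable {ι : Type} {H H' : Type u} [NormedAddCommGroup H] [InnerProductSpace ℂ H]
  [CompleteSpace H] [NormedAddCommGroup H'] [InnerProductSpace ℂ H'] [CompleteSpace H']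
  {C : RowContraction ι H} {C' : RowContraction ι H'}

/-- The characteristic functions have the same `M M*` after identifying the defect spaces
of `C` and `C'` by `u`. -/
def SameGram (u : C.defectSpace ≃ₗᵢ[ℂ] C'.defectSpace) (E : ContractiveLifting C)
    (E' : ContractiveLifting C') : Prop :=
  ∀ g, ‖E.charAdj g‖ = ‖E'.charAdj (mapEquiv u g)‖

/-- Apply the model over `C'` to P = M*(1 ⊗ u)*: it is a contraction and commutes with the adjoint
creations because 1 ⊗ u acts only on coefficients. -/
theorem exists_sameGram (u : C.defectSpace ≃ₗᵢ[ℂ] C'.defectSpace) (E : ContractiveLifting C) :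
    ∃ E' : ContractiveLifting C', E'.IsMinimal ∧ SameGram u E E' := by
  obtain ⟨K, _, _, _, T, hT⟩ := C'.exists_isModel
    (E.charAdj ∘L (mapEquiv u).symm.toLinearIsometry.toContinuousLinearMap)
    (fun g => (E.norm_charAdj_le _).trans_eq ((mapEquiv u).symm.norm_map g))
    (fun i g => by
      obtain ⟨g, rfl⟩ := (mapEquiv u).surjective g
      have h : annihilation i (E.charAdj ((mapEquiv u).symm (mapEquiv u g)))
          = E.charAdj ((mapEquiv u).symm (annihilation i (mapEquiv u g))) := by
        rw [annihilation_mapEquiv, LinearIsometryEquiv.symm_apply_apply,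
          LinearIsometryEquiv.symm_apply_apply, annihilation_charAdj]
      exact h)
  refine ⟨hT.lifting, hT.isMinimal_lifting, fun g => ?_⟩
  rw [hT.norm_charAdj_lifting]
  exact congrArg (fun f => ‖E.charAdj f‖) ((mapEquiv u).symm_apply_apply g).symm

/-- Iterating the commutation relation gives f = L_α* g. Its coordinates do not depend on `E`, which
allows comparison with another lifting. -/
theorem charAdj_apply_word (E : ContractiveLifting C) (g : L2 (List ι) C.defectSpace)
    (α : List ι) : ∃ f : L2 (List ι) C.defectSpace, E.charAdj g α = E.symbolAdj f ∧
      ∀ β, f β = g (α ++ β) := by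
  induction α generalizing g with
  | nil => exact ⟨g, rfl, fun _ => rfl⟩
  | cons i α ih =>
    obtain ⟨f, h1, h2⟩ := ih (annihilation i g)
    refine ⟨f, ?_, h2⟩
    rw [← h1, ← annihilation_charAdj]
    rfl

/-- The e_∅ coefficient of M* g has squared norm ‖M* g‖² − ∑ ‖M* L_i* g‖². Conversely ‖M* g‖² is the
sum of all ‖Θ* L_α* g‖². -/
theorem sameGram_iff_symbolAdj (u : C.defectSpace ≃ₗᵢ[ℂ] C'.defectSpace)
    (E : ContractiveLifting C) (E' : ContractiveLifting C') :
    SameGram u E E' ↔ ∀ g, ‖E.symbolAdj g‖ = ‖E'.symbolAdj (mapEquiv u g)‖ := by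
  constructor
  · intro h g
    refine (sq_eq_sq₀ (norm_nonneg _) (norm_nonneg _)).1 ?_
    have h1 := hasSum_norm_annihilation (E.charAdj g)
    have h2 := hasSum_norm_annihilation (E'.charAdj (mapEquiv u g))
    have h3 : (fun i => ‖annihilation i (E'.charAdj (mapEquiv u g))‖ ^ 2)
        = fun i => ‖annihilation i (E.charAdj g)‖ ^ 2 := funext fun i => by
      rw [annihilation_charAdj, annihilation_charAdj, annihilation_mapEquiv, h]
    rw [h3, ← h g] at h2
    have h4 := h1.unique h2
    rw [symbolAdj_apply, symbolAdj_apply]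
    linarith
  · intro h g
    refine (sq_eq_sq₀ (norm_nonneg _) (norm_nonneg _)).1 ?_
    have h1 := hasSum_norm_sq (E.charAdj g)
    have h2 := hasSum_norm_sq (E'.charAdj (mapEquiv u g))
    have h3 : (fun α => ‖E'.charAdj (mapEquiv u g) α‖ ^ 2)
        = fun α => ‖E.charAdj g α‖ ^ 2 := funext fun α => by
      obtain ⟨f, hf, hf'⟩ := E.charAdj_apply_word g α
      obtain ⟨k, hk, hk'⟩ := E'.charAdj_apply_word (mapEquiv u g) α
      have hfk : k = mapEquiv u f := lp.ext (funext fun β => by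
        rw [hk', mapEquiv_apply, mapEquiv_apply, hf'])
      rw [hf, hk, hfk, h]
    rw [h3] at h2
    exact h1.unique h2

/-- On adjoints, equivalence reads v Θ_E* = Θ_{E'}*(1 ⊗ u). Equal norms make this formula define v,
and the dense ranges make v unitary. -/
theorem symbolsEquivalent_iff_sameGram (u : C.defectSpace ≃ₗᵢ[ℂ] C'.defectSpace)
    {E : ContractiveLifting C} {E' : ContractiveLifting C'} (hE : E.IsMinimal)
    (hE' : E'.IsMinimal) : SymbolsEquivalent u E E' ↔ SameGram u E E' := by
  rw [sameGram_iff_symbolAdj]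
  have hpush : ∀ g : L2 (List ι) C.defectSpace,
      push id Function.injective_id u.toLinearIsometry g = mapEquiv u g := fun _ => rfl
  constructor
  · rintro ⟨v, hv⟩ g
    have h : v (E.symbolAdj g) = E'.symbolAdj (mapEquiv u g) := by
      refine ext_inner_left ℂ fun ε => ?_
      obtain ⟨δ, rfl⟩ := v.surjective ε
      rw [LinearIsometryEquiv.inner_map_map, ← inner_symbol, ← inner_symbol, hv, hpush,
        LinearIsometryEquiv.inner_map_map]
    rw [← h, LinearIsometryEquiv.norm_map]
  · intro h
    obtain ⟨v, hv⟩ := exists_unitary_of_norm_eq E.symbolAdj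
      (E'.symbolAdj ∘L (mapEquiv u).toLinearIsometry.toContinuousLinearMap)
      (E.denseRange_symbolAdj hE)
      ((E'.denseRange_symbolAdj hE').comp (mapEquiv u).surjective.denseRange
        E'.symbolAdj.continuous) h
    refine ⟨v, fun δ => ext_inner_right ℂ fun k => ?_⟩
    obtain ⟨g, rfl⟩ := (mapEquiv (κ := List ι) u).surjective k
    have hv' : v (E.symbolAdj g) = E'.symbolAdj (mapEquiv u g) := hv g
    rw [hpush, LinearIsometryEquiv.inner_map_map, inner_symbol, inner_symbol, ← hv',
      LinearIsometryEquiv.inner_map_map]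

/-- A unitary equivalence must carry one compression to the other, by uniqueness of the compression.
Conversely, equal M M* gives the compressions equal norms, and their dense ranges produce the
unitary. -/
theorem unitarilyEquivalent_iff {E E' : ContractiveLifting C} (hE : E.IsMinimal)
    (hE' : E'.IsMinimal) :
    E.UnitarilyEquivalent E' ↔ ∀ g, ‖E.charAdj g‖ = ‖E'.charAdj g‖ := by
  constructor
  · rintro ⟨U, hU, hU'⟩ g
    have h : ∀ a, U (E.compression a) = E'.compression a := fun a => by
      refine E'.eq_compression (U.toLinearIsometry.toContinuousLinearMap ∘L E.compression)
        (fun x => ?_) (fun i b => ?_) a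
      · exact (congrArg U (E.compression_inl x)).trans (hU' x)
      · exact (congrArg U (E.compression_dilOp i b)).trans (hU i _)
    have h1 := E.norm_compression_sq (inr g)
    have h2 := E'.norm_compression_sq (inr g)
    rw [← h, LinearIsometryEquiv.norm_map, h1, inr_snd] at h2
    refine (sq_eq_sq₀ (norm_nonneg _) (norm_nonneg _)).1 ?_
    linarith
  · intro h
    have hE1 := E.isMinimal_iff.1 hE
    obtain ⟨U, hU⟩ := exists_unitary_of_norm_eq E.compression E'.compression hE1
      (E'.isMinimal_iff.1 hE') fun a => by
        refine (sq_eq_sq₀ (norm_nonneg _) (norm_nonneg _)).1 ?_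
        rw [norm_compression_sq, norm_compression_sq, h]
    refine ⟨U, fun i y => ?_, fun x => ?_⟩
    · refine hE1.induction_on (p := fun y => U (E.tuple.op i y) = E'.tuple.op i (U y)) y
        (isClosed_eq (by fun_prop) (by fun_prop)) fun a => ?_
      rw [← compression_dilOp, hU, hU, compression_dilOp]
    · rw [← compression_inl, ← compression_inl, hU]

theorem SameGram.unitarilyEquivalent_iff {u : C.defectSpace ≃ₗᵢ[ℂ] C'.defectSpace}
    {E F : ContractiveLifting C} {E' F' : ContractiveLifting C'} (hE : E.IsMinimal)
    (hF : F.IsMinimal) (hE' : E'.IsMinimal) (hF' : F'.IsMinimal) (h : SameGram u E E')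
    (h' : SameGram u F F') : E.UnitarilyEquivalent F ↔ E'.UnitarilyEquivalent F' := by
  rw [ContractiveLifting.unitarilyEquivalent_iff hE hF,
    ContractiveLifting.unitarilyEquivalent_iff hE' hF', (mapEquiv u).surjective.forall]
  exact forall_congr' fun g => by rw [h g, h' g]

theorem SameGram.symm {u : C.defectSpace ≃ₗᵢ[ℂ] C'.defectSpace}
    {E : ContractiveLifting C} {E' : ContractiveLifting C'} (h : SameGram u.symm E' E) :
    SameGram u E E' := fun g => by
  have h1 : mapEquiv u.symm (mapEquiv u g) = g := lp.ext (funext fun α => by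
    rw [mapEquiv_apply, mapEquiv_apply, LinearIsometryEquiv.symm_apply_apply])
  rw [h (mapEquiv u g), h1]

end ContractiveLifting

/-! ### The bijection of equivalence classes -/

open ContractiveLifting in
theorem exists_equiv_minimalLiftingClass {ι : Type} {H H' : Type u} [NormedAddCommGroup H]
    [InnerProductSpace ℂ H] [CompleteSpace H] [NormedAddCommGroup H'] [InnerProductSpace ℂ H']
    [CompleteSpace H'] {C : RowContraction ι H} {C' : RowContraction ι H'}
    (u : C.defectSpace ≃ₗᵢ[ℂ] C'.defectSpace) :
    ∃ Φ : MinimalLiftingClass C ≃ MinimalLiftingClass C',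
      ∀ (E : MinimalLifting C) (E' : MinimalLifting C'),
        Φ (Quotient.mk _ E) = Quotient.mk _ E' ↔ SameGram u E.1 E'.1 := by
  have hex : ∀ E : MinimalLifting C, ∃ E' : MinimalLifting C', SameGram u E.1 E'.1 := fun E => by
    obtain ⟨E', h1, h2⟩ := exists_sameGram u E.1
    exact ⟨⟨E', h1⟩, h2⟩
  choose φ hφ using hex
  have hequiv : ∀ E F : MinimalLifting C, E ≈ F ↔ φ E ≈ φ F := fun E F =>
    (hφ E).unitarilyEquivalent_iff E.2 F.2 (φ E).2 (φ F).2 (hφ F)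
  let Φ : MinimalLiftingClass C → MinimalLiftingClass C' :=
    Quotient.map φ fun E F h => (hequiv E F).1 h
  have hmk : ∀ (E : MinimalLifting C) (E' : MinimalLifting C'),
      Φ (Quotient.mk _ E) = Quotient.mk _ E' ↔ SameGram u E.1 E'.1 := fun E E' => by
    have h1 : Φ (Quotient.mk _ E) = Quotient.mk _ E' ↔ (φ E).1.UnitarilyEquivalent E'.1 :=
      Quotient.eq
    rw [h1, ContractiveLifting.unitarilyEquivalent_iff (φ E).2 E'.2,
      (mapEquiv u).surjective.forall]
    exact forall_congr' fun g => by rw [hφ E g]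
  refine ⟨Equiv.ofBijective Φ ⟨?_, ?_⟩, hmk⟩
  · rintro ⟨E⟩ ⟨F⟩ h
    exact Quotient.sound ((hequiv E F).2 (Quotient.exact h))
  · rintro ⟨E'⟩
    -- Surjectivity: the same construction run backwards along u⁻¹.
    obtain ⟨E, h1, h2⟩ := exists_sameGram u.symm E'.1
    exact ⟨Quotient.mk _ ⟨E, h1⟩, (hmk ⟨E, h1⟩ E').2 h2.symm⟩

end

end RowLifting

theorem corollary3p4 {ι : Type} [Countable ι] {H H' : Type u}
    [NormedAddCommGroup H] [InnerProductSpace ℂ H] [CompleteSpace H]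
    [NormedAddCommGroup H'] [InnerProductSpace ℂ H'] [CompleteSpace H']
    (C : RowLifting.RowContraction ι H) (C' : RowLifting.RowContraction ι H')
    (hdefect : C.defect = C'.defect) :
    Nonempty (C.defectSpace ≃ₗᵢ[ℂ] C'.defectSpace) ∧
    ∀ u : C.defectSpace ≃ₗᵢ[ℂ] C'.defectSpace,
      ∃ Φ : RowLifting.MinimalLiftingClass C ≃ RowLifting.MinimalLiftingClass C',
        ∀ (E : RowLifting.MinimalLifting C) (E' : RowLifting.MinimalLifting C'),
          Φ (Quotient.mk _ E) = Quotient.mk _ E' ↔ RowLifting.SymbolsEquivalent u E.1 E'.1 := by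
  refine ⟨RowLifting.nonempty_unitary_of_hilbertDim_eq hdefect, fun u => ?_⟩
  obtain ⟨Φ, hΦ⟩ := RowLifting.exists_equiv_minimalLiftingClass u
  exact ⟨Φ, fun E E' => (hΦ E E').trans
    (RowLifting.ContractiveLifting.symbolsEquivalent_iff_sameGram u E.2 E'.2).symm⟩
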